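/- Let $T\ge 1$, let $X_1,\dots,X_T$ be random variables on a probability space with values in a separable Banach space $\mathcal X$, and let $f:\mathcal X\to\mathbb R$ be measurable. For $0\le k<T$ let $\pi_{k+1}(\cdot\mid x_{1:k})$ be a regular conditional distribution of $X_{k+1}$ given $X_{1:k}=x_{1:k}$, from which one can sample. Let $U_T=\sup_\tau \mathbb E[f(X_\tau)]$, the supremum being over all stopping times $\tau$ of the natural filtration with values in $\{1,\dots,T\}$, and for $1\le k\le T-1$ let $U_{T-k}(x_{1:k})=\sup_{\tau}\mathbb E[f(X_\tau)\mid X_{1:k}=x_{1:k}]$ be the value, given the history $x_{1:k}$, of the stopping problem with $\tau\in\{k+1,\dots,T\}$. Assume that * $\mathbb E\|X_i\|^{2+\delta}<\infty$ for all $1\le i\le T$, for some $\delta>0$; * $|f(x)|\le L(1+\|x\|)$ for all $x\in\mathcal X$, for some constant $L$; * there is a constant $C$ with $\mathbb P\big(|U_{T-k}(X_1,\dots,X_k)-f(X_k)|<\varepsilon\big)\le C\varepsilon$ for all $\varepsilon>0$ and $1\le k\le T-1$. Let $0<\eta\le\delta$ with $\eta<1/4$, and for $1\le i\le T-1$ put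 $$r_i=1-2^{-\frac{2+9d_i/(80+40d_i)}{2+d_i/10}},\qquad d_i=\eta\cdot 10^{\,i+1-T}.$$ The multi-stage MUSE is the following recursive randomized algorithm, started with $k=0$ and the empty history. Given $x_{1:k}$, sample $x_{k+1}\sim\pi_{k+1}(\cdot\mid x_{1:k})$. If $k=T-1$, return $f(x_T)$. Otherwise sample independently $N$ with $\mathbb P(N=n)=p(n):=r_{k+1}(1-r_{k+1})^n$, $n\ge0$, call the algorithm independently $2^N$ times with the history $x_{1:k+1}$ to get $Y(1),\dots,Y(2^N)$, and return $\Delta_N/p(N)$, where $\Delta_0=\max\{f(x_{k+1}),Y(1)\}$ and, for $N\ge1$, $$\Delta_N=\max\{f(x_{k+1}),A\}-\tfrac12\big[\max\{f(x_{k+1}),A^O\}+\max\{f(x_{k+1}),A^E\}\big],$$ $A$, $A^O$, $A^E$ being the averages of the $Y(j)$ over all $j$, the odd $j$ and the even $j$. The computational cost is the random number of units used, where sampling one random variable, evaluating $f$ once, and performing one arithmetic operation cost one unit each. Then the output $Y_1$ of the multi-stage MUSE has a finite second moment, and there is a constant $K$, not depending on $\varepsilon$, such that for every $\varepsilon>0$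 the average $Y$ of $n=\max\{1,\lceil \mathrm{Var}(Y_1)/\varepsilon^2\rceil\}$ i.i.d. copies of $Y_1$ satisfies $$\mathbb E\big[(Y-U_T)^2\big]\le\varepsilon^2,$$ and the expected computational cost of $Y$ is at most $K\max\{1,1/\varepsilon^2\}$; in particular it is $O(1/\varepsilon^2)$ as $\varepsilon\to0$. -/

import Mathlib

open MeasureTheory ProbabilityTheory

noncomputable section

namespace MUSE

variable {𝒳 : Type*} [MeasurableSpace 𝒳]

/-! ### Histories and simulators

Times are numbered from `0`: `X i` is the `(i + 1)`-st observation. A history of length `k` is an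
element of `Fin k → 𝒳`. -/

/-- The first `k` observations of the process. -/
def past {Ω : Type*} {T : ℕ} (X : Fin T → Ω → 𝒳) (k : ℕ) (hk : k ≤ T) (ω : Ω) : Fin k → 𝒳 :=
  fun i => X (Fin.castLE hk i) ω

/-- Append an observation to a history. -/
def extend {k : ℕ} (p : (Fin k → 𝒳) × 𝒳) : Fin (k + 1) → 𝒳 :=
  Fin.snoc (α := fun _ => 𝒳) p.1 p.2

/-- Put an observation in front of a path. -/
def prepend {m : ℕ} (p : 𝒳 × (Fin m → 𝒳)) : Fin (m + 1) → 𝒳 :=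
  Fin.cons (α := fun _ => 𝒳) p.1 p.2

lemma measurable_extend {k : ℕ} : Measurable (extend (𝒳 := 𝒳) (k := k)) := by
  refine measurable_pi_iff.2 fun i => ?_
  refine Fin.lastCases ?_ (fun j => ?_) i
  · simpa [extend] using measurable_snd
  · simp only [extend, Fin.snoc_castSucc]
    fun_prop

/-- The kernels `π` simulate the process `X`: for every `k < T`, `π k` is (a version of) the
conditional distribution of the next observation given the first `k` observations. -/
def Simulates {Ω : Type*} [MeasurableSpace Ω] (P : Measure Ω) {T : ℕ} (X : Fin T → Ω → 𝒳)
    (π : (k : ℕ) → Kernel (Fin k → 𝒳) 𝒳) : Prop :=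
  ∀ (k : ℕ) (hk : k < T), HasCondDistrib (X ⟨k, hk⟩) (past X k hk.le) (π k) P

/-- The conditional law of the next `m` observations given a history of length `k`. -/
def tailLaw (π : (k : ℕ) → Kernel (Fin k → 𝒳) 𝒳) :
    (m k : ℕ) → Kernel (Fin k → 𝒳) (Fin m → 𝒳)
  | 0, _ => Kernel.const _ (Measure.dirac Fin.elim0)
  | m + 1, k => (π k ⊗ₖ (tailLaw π m (k + 1)).comap extend measurable_extend).map prepend

/-! ### Optimal stopping -/

section Stopping

variable [TopologicalSpace 𝒳] [TopologicalSpace.MetrizableSpace 𝒳] [BorelSpace 𝒳]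

/-- The value `sup_τ E[f(Z_τ)]` of the optimal stopping problem for the process
`Z_0, …, Z_{m-1}`, over all stopping times of its natural filtration with values in
`{0, …, m - 1}`. -/
def stoppingValue {Ω : Type*} [MeasurableSpace Ω] (μ : Measure Ω) {m : ℕ} (Z : Fin m → Ω → 𝒳)
    (hZ : ∀ i, StronglyMeasurable (Z i)) (f : 𝒳 → ℝ) : ℝ :=
  sSup {v : ℝ | ∃ τ : Ω → Fin m,
    IsStoppingTime (Filtration.natural Z hZ) (fun ω => (τ ω : WithTop (Fin m))) ∧
    v = ∫ ω, f (Z (τ ω) ω) ∂μ}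

/-- The conditional utility: the value of the stopping problem with `m` remaining observations,
given the history `h` of the first `k` observations. -/
def condUtility [SecondCountableTopology 𝒳] (π : (k : ℕ) → Kernel (Fin k → 𝒳) 𝒳) (f : 𝒳 → ℝ)
    (m k : ℕ) (h : Fin k → 𝒳) : ℝ :=
  stoppingValue (tailLaw π m k h) (fun (i : Fin m) (x : Fin m → 𝒳) => x i)
    (fun i => (measurable_pi_apply i).stronglyMeasurable) f

end Stopping

/-! ### The multi-stage estimator

A randomized algorithm that is given a history is described by the kernel that sends the history to
the joint law of its real output and of the number of units of computation it has used. Sampling one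
random variable and performing one arithmetic operation (addition, subtraction, multiplication,
division, maximum, evaluation of `f`) cost one unit each. -/

/-- `n` conditionally independent runs of the randomized procedure `K`. (The value for kernels that
are not Markov is irrelevant.) -/
def iid {α β : Type*} [MeasurableSpace α] [MeasurableSpace β] (K : Kernel α β) (n : ℕ) :
    Kernel α (Fin n → β) :=
  open Classical in
  if hK : IsMarkovKernel K then
    { toFun := fun a => Measure.pi fun _ : Fin n => K a
      measurable' := by
        have := hK
        refine Measurable.measure_of_isPiSystem_of_isProbabilityMeasure
          generateFrom_pi.symm isPiSystem_pi ?_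
        rintro _ ⟨s, hs, rfl⟩
        simp only [Measure.pi_pi]
        exact Finset.measurable_prod _ fun i _ => K.measurable_coe (hs i (Set.mem_univ i)) }
  else 0

/-- The probability mass function `p_r(n) = r (1 - r) ^ n` of the geometric distribution. -/
def geoPMF (r : unitInterval) (n : ℕ) : ℝ := r * (1 - r) ^ n

/-- The antithetic difference `Δ_n` built from `a = f(x)` and `2 ^ n` numbers `y`. The sums over odd
and even positions (numbered from `1`) run over the indices `2 * i` and `2 * i + 1` of `y`. -/
def delta : (n : ℕ) → ℝ → (Fin (2 ^ n) → ℝ) → ℝ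
  | 0, a, y => max a (y 0)
  | n + 1, a, y =>
    max a ((∑ i, y i) / 2 ^ (n + 1)) -
      1 / 2 * (max a ((∑ i : Fin (2 ^ n), y ⟨2 * i, by have := i.2; rw [pow_succ]; omega⟩) / 2 ^ n) +
        max a ((∑ i : Fin (2 ^ n), y ⟨2 * i + 1, by have := i.2; rw [pow_succ]; omega⟩) / 2 ^ n))

/-- The number of arithmetic operations needed to compute `Δ_n / p_r(n)` from `f(x)` and the `2 ^ n`
numbers. For `n = 0`: a maximum, and a division by `p_r(0) = r`. For `n + 1`: the three sums take
`(2 ^ (n + 1) - 1) + 2 * (2 ^ n - 1) = 2 ^ (n + 2) - 3` additions, the powers of two `n`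
multiplications, `Δ` another `3` divisions, `3` maxima, and `3` operations to combine them,
`p_r(n + 1)` takes a subtraction and `n + 1` multiplications, and there is one last division. -/
def arithCost : ℕ → ℕ
  | 0 => 2
  | n + 1 => 2 ^ (n + 2) + 2 * n + 9

/-- Output and cost of one call that has sampled the observation `x` and the level `n` and whose
`2 ^ n` recursive calls have returned the outputs and costs `y`; here `a = f(x)`. The summand `3`
pays for sampling `x`, for sampling `n`, and for evaluating `f`. -/
def combine (r : unitInterval) (n : ℕ) (a : ℝ) (y : Fin (2 ^ n) → ℝ × ℕ) : ℝ × ℕ :=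
  (delta n a (fun i => (y i).1) / geoPMF r n, (∑ i, (y i).2) + 3 + arithCost n)

/-- The remainder of a call, after the history has been extended to length `k + 1` and the level `n`
has been sampled: run the procedure `K` on the extended history `2 ^ n` times and combine. -/
def branch (f : 𝒳 → ℝ) (r : unitInterval) {k : ℕ} (K : Kernel (Fin (k + 1) → 𝒳) (ℝ × ℕ)) :
    Kernel ((Fin (k + 1) → 𝒳) × ℕ) (ℝ × ℕ) where
  toFun p := ((Kernel.id ×ₖ iid K (2 ^ p.2)).map
    fun q => combine r p.2 (f (q.1 (Fin.last k))) q.2) p.1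
  measurable' := measurable_from_prod_countable_left fun n => Kernel.measurable
    ((Kernel.id ×ₖ iid K (2 ^ n)).map fun q => combine r n (f (q.1 (Fin.last k))) q.2)

/-- The multi-stage estimator for a history of length `k` with `m + 1` observations to come: the
joint law of output and cost. With one observation to come, sample it and return its reward.
Otherwise sample the next observation `x` given the history and, independently, the level
`n ~ Geo(r (k + 1))`, call the estimator `2 ^ n` times on the extended history, and return
`Δ_n / p_r(n)`. -/
def muse (π : (k : ℕ) → Kernel (Fin k → 𝒳) 𝒳) (f : 𝒳 → ℝ) (r : ℕ → unitInterval) :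
    (m k : ℕ) → Kernel (Fin k → 𝒳) (ℝ × ℕ)
  | 0, k => (π k).map fun x => (f x, 2)
  | m + 1, k =>
    branch f (r (k + 1)) (muse π f r m (k + 1)) ∘ₖ
      ((Kernel.id ×ₖ π k).map extend ×ₖ Kernel.const _ (geometricMeasure (r (k + 1))))

/-- Joint law of output and cost of the multi-stage estimator for horizon `T ≥ 1`, started from the
empty history. -/
def museLaw (π : (k : ℕ) → Kernel (Fin k → 𝒳) 𝒳) (f : 𝒳 → ℝ) (r : ℕ → unitInterval) (T : ℕ) :
    Measure (ℝ × ℕ) :=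
  muse π f r (T - 1) 0 Fin.elim0

/-- Joint law of output and cost of the average of `n` independent runs of an algorithm with law
`μ`. Averaging takes `n - 1` additions and one division. -/
def averageLaw (μ : Measure (ℝ × ℕ)) (n : ℕ) : Measure (ℝ × ℕ) :=
  (Measure.pi fun _ : Fin n => μ).map fun y => ((∑ i, (y i).1) / n, (∑ i, (y i).2) + n)

/-- The exponent `(2 + 9 d / (80 + 40 d)) / (2 + δ 10 ^ (i - T))` with `d = δ 10 ^ (i + 1 - T)`. -/
def rate (T : ℕ) (δ : ℝ) (i : ℕ) : ℝ :=
  (2 + 9 * (δ * (10 : ℝ) ^ ((i : ℤ) + 1 - T)) / (80 + 40 * (δ * (10 : ℝ) ^ ((i : ℤ) + 1 - T)))) /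
    (2 + δ * (10 : ℝ) ^ ((i : ℤ) - T))

lemma rate_nonneg (T : ℕ) {δ : ℝ} (hδ : 0 < δ) (i : ℕ) : 0 ≤ rate T δ i := by
  unfold rate; positivity

/-- The parameter `r_i = 1 - 2 ^ (- rate)` of the `i`-th level variable, `1 ≤ i ≤ T - 1`. -/
def museParam (T : ℕ) (δ : ℝ) (hδ : 0 < δ) (i : ℕ) : unitInterval :=
  ⟨1 - (2 : ℝ) ^ (-rate T δ i), by
    constructor
    · have : (2 : ℝ) ^ (-rate T δ i) ≤ 1 :=
        Real.rpow_le_one_of_one_le_of_nonpos one_le_two (neg_nonpos.2 (rate_nonneg T hδ i))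
      linarith
    · have : 0 < (2 : ℝ) ^ (-rate T δ i) := Real.rpow_pos_of_pos two_pos _
      linarith⟩

/-- The number of copies to average: `V / ε ^ 2`, rounded up to a positive integer. -/
def sampleSize (V ε : ℝ) : ℕ := max 1 ⌈V / ε ^ 2⌉₊

end MUSE

end

/-!
The estimator is unbiased because the `Δ n` telescope, in mean, to the maximum of `f` at the current
state and the continuation value, and dividing by the law of `N` undoes the randomization. The
difference `Δ n` vanishes unless the two antithetic averages lie on different sides of the value of
`f`; since the continuation value is rarely close to it, the Marcinkiewicz–Zygmund inequality shows
that, for an exponent `p` slightly above `2`, the `p`-th moment of `Δ n` decays faster than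
`2 ^ (-n * (p - 1))`. This leaves room for geometric parameters `r > 1 / 2`, for which both the
moment of the output and the expected cost are finite. Each stage gives up a part of the moment
exponent, whence the geometric sequence `d_i`. The backward recursion for the continuation values is
identified with the optimal stopping value through the Snell envelope.
-/

noncomputable section

namespace MUSE

variable {𝒳 : Type*} [MeasurableSpace 𝒳]

/-! ### Kernels of the estimator -/

lemma iid_apply {α β : Type*} [MeasurableSpace α] [MeasurableSpace β] (K : Kernel α β)
    [hK : IsMarkovKernel K] (n : ℕ) (a : α) : iid K n a = Measure.pi fun _ : Fin n => K a := by
  simp only [iid, dif_pos hK]; rfl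

instance isMarkovKernel_iid {α β : Type*} [MeasurableSpace α] [MeasurableSpace β] (K : Kernel α β)
    [IsMarkovKernel K] (n : ℕ) : IsMarkovKernel (iid K n) :=
  ⟨fun a => by rw [iid_apply]; infer_instance⟩

lemma measurable_lintegral_pi {α β : Type*} [MeasurableSpace α] [MeasurableSpace β]
    (K : Kernel α β) [IsMarkovKernel K] {n : ℕ} {F : α → (Fin n → β) → ENNReal}
    (hF : Measurable (Function.uncurry F)) :
    Measurable fun a => ∫⁻ y, F a y ∂Measure.pi fun _ => K a := by
  simp_rw [← iid_apply]
  exact hF.lintegral_kernel_prod_right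

lemma measurable_delta (n : ℕ) :
    Measurable fun q : ℝ × (Fin (2 ^ n) → ℝ) => delta n q.1 q.2 := by
  cases n with
  | zero => simp only [delta]; fun_prop
  | succ n => simp only [delta]; fun_prop

lemma measurable_combine (r : unitInterval) (n : ℕ) :
    Measurable fun q : ℝ × (Fin (2 ^ n) → ℝ × ℕ) => combine r n q.1 q.2 := by
  refine Measurable.prodMk ?_ ?_
  · refine Measurable.div_const ?_ _
    exact (measurable_delta n).comp (f := fun q : ℝ × (Fin (2 ^ n) → ℝ × ℕ) =>
      (q.1, fun i => (q.2 i).1)) (by fun_prop)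
  · fun_prop

lemma measurable_combine_last {f : 𝒳 → ℝ} (hf : Measurable f) (r : unitInterval) (n k : ℕ) :
    Measurable fun q : (Fin (k + 1) → 𝒳) × (Fin (2 ^ n) → ℝ × ℕ) =>
      combine r n (f (q.1 (Fin.last k))) q.2 :=
  (measurable_combine r n).comp (f := fun q : (Fin (k + 1) → 𝒳) × (Fin (2 ^ n) → ℝ × ℕ) =>
    (f (q.1 (Fin.last k)), q.2)) (by fun_prop)

lemma branch_apply (f : 𝒳 → ℝ) (r : unitInterval) {k : ℕ}
    (K : Kernel (Fin (k + 1) → 𝒳) (ℝ × ℕ)) (p : (Fin (k + 1) → 𝒳) × ℕ) :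
    branch f r K p = ((Kernel.id ×ₖ iid K (2 ^ p.2)).map
      fun q => combine r p.2 (f (q.1 (Fin.last k))) q.2) p.1 := rfl

lemma isMarkovKernel_branch {f : 𝒳 → ℝ} (hf : Measurable f) (r : unitInterval) {k : ℕ}
    (K : Kernel (Fin (k + 1) → 𝒳) (ℝ × ℕ)) [IsMarkovKernel K] : IsMarkovKernel (branch f r K) := by
  refine ⟨fun p => ?_⟩
  rw [branch_apply]
  have := Kernel.IsMarkovKernel.map (Kernel.id ×ₖ iid K (2 ^ p.2))
    (measurable_combine_last hf r p.2 k)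
  infer_instance

lemma isMarkovKernel_muse (π : (k : ℕ) → Kernel (Fin k → 𝒳) 𝒳) [∀ k, IsMarkovKernel (π k)]
    {f : 𝒳 → ℝ} (hf : Measurable f) (r : ℕ → unitInterval) (m k : ℕ) :
    IsMarkovKernel (muse π f r m k) := by
  induction m generalizing k with
  | zero => exact Kernel.IsMarkovKernel.map _ (by fun_prop)
  | succ m ih =>
    have := ih (k + 1)
    have := isMarkovKernel_branch hf (r (k + 1)) (muse π f r m (k + 1))
    have := Kernel.IsMarkovKernel.map (Kernel.id ×ₖ π k) (measurable_extend (𝒳 := 𝒳) (k := k))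
    rw [muse]; infer_instance

@[simp] lemma extend_last {E : Type*} {k : ℕ} (h : Fin k → E) (x : E) :
    extend (h, x) (Fin.last k) = x := by
  simp [extend]

lemma lintegral_muse_zero (π : (k : ℕ) → Kernel (Fin k → 𝒳) 𝒳) {f : 𝒳 → ℝ} (hf : Measurable f)
    (r : ℕ → unitInterval) (k : ℕ) (h : Fin k → 𝒳) {F : ℝ × ℕ → ENNReal} (hF : Measurable F) :
    ∫⁻ z, F z ∂muse π f r 0 k h = ∫⁻ x, F (f x, 2) ∂π k h := by
  rw [muse, Kernel.lintegral_map _ (by fun_prop) _ hF]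

lemma lintegral_branch {f : 𝒳 → ℝ} (hf : Measurable f) (r : unitInterval) {k : ℕ}
    (K : Kernel (Fin (k + 1) → 𝒳) (ℝ × ℕ)) [IsMarkovKernel K] (h : Fin (k + 1) → 𝒳) (n : ℕ)
    {F : ℝ × ℕ → ENNReal} (hF : Measurable F) :
    ∫⁻ z, F z ∂branch f r K (h, n) =
      ∫⁻ y, F (combine r n (f (h (Fin.last k))) y) ∂Measure.pi fun _ : Fin (2 ^ n) => K h := by
  have hc := measurable_combine_last hf r n k
  rw [branch_apply, Kernel.lintegral_map _ hc _ hF, ← iid_apply]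
  exact Kernel.lintegral_id_prod (hF.comp hc) _ _

lemma lintegral_geometricMeasure {r : unitInterval} (hr : r ≠ 0) (F : ℕ → ENNReal) :
    ∫⁻ n, F n ∂geometricMeasure r = ∑' n, ENNReal.ofReal (geoPMF r n) * F n := by
  rw [geometricMeasure_eq hr, lintegral_sum_measure]
  refine tsum_congr fun n => ?_
  rw [lintegral_smul_measure, lintegral_dirac, geoPMF, mul_comm (r : ℝ), smul_eq_mul]

lemma lintegral_muse_succ (π : (k : ℕ) → Kernel (Fin k → 𝒳) 𝒳) [∀ k, IsMarkovKernel (π k)]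
    {f : 𝒳 → ℝ} (hf : Measurable f) (r : ℕ → unitInterval) (m k : ℕ) (hr : r (k + 1) ≠ 0)
    (h : Fin k → 𝒳) {F : ℝ × ℕ → ENNReal} (hF : Measurable F) :
    ∫⁻ z, F z ∂muse π f r (m + 1) k h = ∫⁻ x, ∑' n, ENNReal.ofReal (geoPMF (r (k + 1)) n) *
      ∫⁻ y, F (combine (r (k + 1)) n (f x) y)
        ∂Measure.pi (fun _ : Fin (2 ^ n) => muse π f r m (k + 1) (extend (h, x))) ∂π k h := by
  have := isMarkovKernel_muse π hf r m (k + 1)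
  have := isMarkovKernel_branch hf (r (k + 1)) (muse π f r m (k + 1))
  have := Kernel.IsMarkovKernel.map (Kernel.id ×ₖ π k) (measurable_extend (𝒳 := 𝒳) (k := k))
  rw [muse, Kernel.lintegral_comp _ _ _ hF, Kernel.lintegral_prod _ _ _ hF.lintegral_kernel,
    Kernel.lintegral_map _ measurable_extend, Kernel.lintegral_id_prod]
  · refine lintegral_congr fun x => ?_
    rw [Kernel.const_apply, lintegral_geometricMeasure hr]
    refine tsum_congr fun n => ?_
    rw [lintegral_branch hf _ _ _ _ hF, extend_last]
  · refine Measurable.lintegral_prod_right' (f := fun q : ((Fin k → 𝒳) × 𝒳) × ℕ =>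
      ∫⁻ b, F b ∂branch f (r (k + 1)) (muse π f r m (k + 1)) (extend q.1, q.2)) ?_
    exact hF.lintegral_kernel.comp (by have := measurable_extend (𝒳 := 𝒳) (k := k); fun_prop)
  · exact Measurable.lintegral_prod_right' hF.lintegral_kernel

/-! ### A Marcinkiewicz–Zygmund inequality -/

section MomentInequality

lemma abs_rpow_sub_abs_rpow_le {p : ℝ} (hp : 1 < p) (x y : ℝ) :
    |x| ^ p - |y| ^ p ≤ p * |x| ^ (p - 2) * x * (x - y) := by
  have hconv : ConvexOn ℝ Set.univ fun z : ℝ => |z| ^ p :=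
    ⟨convex_univ, fun u _ v _ a b ha hb hab =>
      (Real.rpow_le_rpow (abs_nonneg _)
        (convexOn_univ_norm.2 (Set.mem_univ u) (Set.mem_univ v) ha hb hab) (by linarith)).trans
        ((convexOn_rpow hp.le).2 (abs_nonneg u) (abs_nonneg v) ha hb hab)⟩
  have hderiv := hasDerivAt_abs_rpow x hp
  rcases lt_trichotomy x y with h | rfl | h
  · have := hconv.le_slope_of_hasDerivAt (Set.mem_univ x) (Set.mem_univ y) h hderiv
    rw [slope_def_field, le_div_iff₀ (sub_pos.2 h)] at this
    linarith
  · simp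
  · have := hconv.slope_le_of_hasDerivAt (Set.mem_univ y) (Set.mem_univ x) h hderiv
    rw [slope_def_field, div_le_iff₀ (sub_pos.2 h)] at this
    linarith

lemma abs_rpow_sub_rpow_le {q x y : ℝ} (hq : 1 ≤ q) (hx : 0 ≤ x) (hy : 0 ≤ y) :
    |x ^ q - y ^ q| ≤ q * max x y ^ (q - 1) * |x - y| := by
  refine Convex.norm_image_sub_le_of_norm_hasDerivWithin_le (𝕜 := ℝ) (s := Set.Icc 0 (max x y))
    (f := fun z => z ^ q) (f' := fun z => q * z ^ (q - 1))
    (fun z _ => (Real.hasDerivAt_rpow_const (Or.inr hq)).hasDerivWithinAt) (fun z hz => ?_)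
    (convex_Icc _ _) ⟨hy, le_max_right _ _⟩ ⟨hx, le_max_left _ _⟩
  have hz0 : 0 ≤ z := hz.1
  rw [Real.norm_of_nonneg (by positivity)]
  gcongr
  exact hz.2

lemma abs_rpow_sub_rpow_mul_le {s x y : ℝ} (hs : 0 ≤ s) (hx : 0 ≤ x) (hy : 0 ≤ y) :
    |x ^ s - y ^ s| * y ≤ (s + 2) * max x y ^ s * |x - y| := by
  have hpow : ∀ z : ℝ, 0 ≤ z → z ^ (s + 1) = z ^ s * z := fun z hz => by
    rw [Real.rpow_add_of_nonneg hz hs zero_le_one, Real.rpow_one]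
  have hdiff := abs_rpow_sub_rpow_le (q := s + 1) (by linarith) hx hy
  rw [hpow x hx, hpow y hy, add_sub_cancel_right] at hdiff
  calc |x ^ s - y ^ s| * y = |(x ^ s * x - y ^ s * y) - x ^ s * (x - y)| := by
        rw [← abs_of_nonneg hy, ← abs_mul, abs_of_nonneg hy]; ring_nf
    _ ≤ |x ^ s * x - y ^ s * y| + |x ^ s * (x - y)| := abs_sub _ _
    _ ≤ (s + 1) * max x y ^ s * |x - y| + max x y ^ s * |x - y| := by
        rw [abs_mul, abs_of_nonneg (Real.rpow_nonneg hx s)]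
        gcongr
        exact le_max_left x y
    _ = _ := by ring

lemma max_rpow_le_add {s x y : ℝ} (hx : 0 ≤ x) (hy : 0 ≤ y) : max x y ^ s ≤ x ^ s + y ^ s := by
  rcases max_choice x y with h | h <;> rw [h]
  · exact le_add_of_nonneg_right (Real.rpow_nonneg hy s)
  · exact le_add_of_nonneg_left (Real.rpow_nonneg hx s)

lemma add_rpow_le_two_rpow_mul {s x y : ℝ} (hs : 0 ≤ s) (hx : 0 ≤ x) (hy : 0 ≤ y) :
    (x + y) ^ s ≤ 2 ^ s * (x ^ s + y ^ s) :=
  calc (x + y) ^ s ≤ (2 * max x y) ^ s := by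
        gcongr; linarith [le_max_left x y, le_max_right x y]
    _ = 2 ^ s * max x y ^ s := Real.mul_rpow two_pos.le (hx.trans (le_max_left x y))
    _ ≤ _ := by gcongr; exact max_rpow_le_add hx hy

/-- The constant of the second-order expansion of `|x| ^ p`, not optimized. -/
def expansionConst (p : ℝ) : ℝ := p * (p + 1) * 2 ^ (p - 2)

lemma one_le_expansionConst {p : ℝ} (hp : 2 ≤ p) : 1 ≤ expansionConst p := by
  have : 1 ≤ (2 : ℝ) ^ (p - 2) := Real.one_le_rpow one_le_two (by linarith)
  calc (1 : ℝ) ≤ p * (p + 1) * 1 := by nlinarith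
    _ ≤ p * (p + 1) * 2 ^ (p - 2) := by gcongr

lemma abs_add_rpow_le {p : ℝ} (hp : 2 ≤ p) (a b : ℝ) :
    |a + b| ^ p ≤ |a| ^ p + p * (|a| ^ (p - 2) * a * b) +
      expansionConst p * (|a| ^ (p - 2) * b ^ 2 + |b| ^ p) := by
  have htangent := abs_rpow_sub_abs_rpow_le (by linarith : 1 < p) (a + b) a
  have hs : 0 ≤ p - 2 := by linarith
  set s := p - 2 with hs_def
  set M := max |a + b| |a|
  have hM : M ^ s ≤ 2 ^ s * (|a| ^ s + |b| ^ s) :=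
    (Real.rpow_le_rpow (by positivity) (max_le (abs_add_le a b) (by simp)) hs).trans
      (add_rpow_le_two_rpow_mul hs (abs_nonneg a) (abs_nonneg b))
  have hfirst : (|a + b| ^ s - |a| ^ s) * a * b ≤ (s + 2) * M ^ s * b ^ 2 := by
    have hdist : |(|a + b| - |a|)| ≤ |b| := by simpa using abs_abs_sub_abs_le_abs_sub (a + b) a
    calc (|a + b| ^ s - |a| ^ s) * a * b ≤ |(|a + b| ^ s - |a| ^ s)| * |a| * |b| := by
          rw [← abs_mul, ← abs_mul]; exact le_abs_self _
      _ ≤ (s + 2) * M ^ s * |b| * |b| := by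
          refine mul_le_mul_of_nonneg_right ?_ (abs_nonneg b)
          exact (abs_rpow_sub_rpow_mul_le hs (abs_nonneg _) (abs_nonneg _)).trans (by gcongr)
      _ = _ := by rw [mul_assoc, ← sq, sq_abs]
  have hsecond : |a + b| ^ s * b ^ 2 ≤ M ^ s * b ^ 2 := by
    gcongr; exact le_max_left _ _
  have hb : |b| ^ s * b ^ 2 = |b| ^ p := by
    rw [← sq_abs, ← Real.rpow_two, ← Real.rpow_add_of_nonneg (abs_nonneg b) hs two_pos.le, hs_def,
      sub_add_cancel]
  calc |a + b| ^ p ≤ |a| ^ p + p * (|a| ^ s * a * b) +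
        p * ((|a + b| ^ s - |a| ^ s) * a * b + |a + b| ^ s * b ^ 2) := by linarith
    _ ≤ |a| ^ p + p * (|a| ^ s * a * b) + p * ((p + 1) * M ^ s * b ^ 2) := by
        gcongr; linarith
    _ ≤ |a| ^ p + p * (|a| ^ s * a * b) +
          p * ((p + 1) * (2 ^ s * (|a| ^ s + |b| ^ s)) * b ^ 2) := by gcongr
    _ = _ := by rw [expansionConst, ← hb]; ring

variable {Ω : Type*} [MeasurableSpace Ω] {μ : Measure Ω} {p : ℝ}


lemma integrable_abs_rpow [IsFiniteMeasure μ] {q : ℝ} (hq : 0 ≤ q) (hqp : q ≤ p) {Y : Ω → ℝ}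
    (hY : MemLp Y (ENNReal.ofReal p) μ) : Integrable (fun ω => |Y ω| ^ q) μ := by
  have := (hY.mono_exponent (ENNReal.ofReal_le_ofReal hqp)).integrable_norm_rpow'
  rwa [ENNReal.toReal_ofReal hq] at this

lemma integral_abs_rpow_le_rpow [IsProbabilityMeasure μ] {q : ℝ} (hq : 0 ≤ q) (hqp : q ≤ p)
    (hp : 0 < p) {Y : Ω → ℝ} (hY : MemLp Y (ENNReal.ofReal p) μ) :
    ∫ ω, |Y ω| ^ q ∂μ ≤ (∫ ω, |Y ω| ^ p ∂μ) ^ (q / p) := by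
  rcases hq.eq_or_lt with rfl | hq
  · simp
  have hpow : ∀ ω, (|Y ω| ^ q) ^ (p / q) = |Y ω| ^ p := fun ω => by
    rw [← Real.rpow_mul (abs_nonneg _), mul_div_cancel₀ _ hq.ne']
  have hjensen := (convexOn_rpow ((one_le_div hq).2 hqp)).map_integral_le (μ := μ)
    (f := fun ω => |Y ω| ^ q) (continuousOn_id.rpow_const fun _ _ => Or.inr (by positivity))
    isClosed_Ici (ae_of_all _ fun ω => by simp only [Set.mem_Ici]; positivity)
    (integrable_abs_rpow hq.le hqp hY)
    (by simpa only [Function.comp_def, hpow] using integrable_abs_rpow hp.le le_rfl hY)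
  simp only [hpow] at hjensen
  have h0 : 0 ≤ ∫ ω, |Y ω| ^ q ∂μ := integral_nonneg fun ω => by positivity
  have := Real.rpow_le_rpow (by positivity) hjensen (by positivity : 0 ≤ q / p)
  rwa [← Real.rpow_mul h0, div_mul_div_cancel₀ hq.ne', div_self hp.ne', Real.rpow_one] at this

lemma integral_abs_add_rpow_le [IsProbabilityMeasure μ] (hp : 2 ≤ p) {S Y : Ω → ℝ}
    (hS : MemLp S (ENNReal.ofReal p) μ) (hY : MemLp Y (ENNReal.ofReal p) μ) (hSY : IndepFun S Y μ)
    (hY0 : ∫ ω, Y ω ∂μ = 0) :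
    ∫ ω, |S ω + Y ω| ^ p ∂μ ≤ ∫ ω, |S ω| ^ p ∂μ + expansionConst p *
      ((∫ ω, |S ω| ^ (p - 2) ∂μ) * ∫ ω, |Y ω| ^ (2 : ℝ) ∂μ + ∫ ω, |Y ω| ^ p ∂μ) := by
  have hS1 : Integrable (fun ω => |S ω| ^ (p - 2) * S ω) μ := by
    refine (integrable_abs_rpow (q := p - 1) (by linarith) (by linarith) hS).mono'
      ((hS.1.aemeasurable.abs.pow_const _).mul hS.1.aemeasurable).aestronglyMeasurable
      (ae_of_all _ fun ω => ?_)
    rw [norm_mul, Real.norm_of_nonneg (by positivity), Real.norm_eq_abs,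
      ← Real.rpow_add_one' (abs_nonneg _) (by linarith)]
    exact le_of_eq (by ring_nf)
  have hS2 := integrable_abs_rpow (q := p - 2) (by linarith) (by linarith) hS
  have hY1 : Integrable Y μ := hY.integrable (ENNReal.one_le_ofReal.2 (by linarith))
  have hY2 := integrable_abs_rpow two_pos.le hp hY
  have hSp := integrable_abs_rpow (by linarith) le_rfl hS
  have hYp := integrable_abs_rpow (by linarith) le_rfl hY
  have hind1 : IndepFun (fun ω => |S ω| ^ (p - 2) * S ω) Y μ :=
    hSY.comp (φ := fun x => |x| ^ (p - 2) * x) (ψ := id) (by fun_prop) measurable_id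
  have hind2 : IndepFun (fun ω => |S ω| ^ (p - 2)) (fun ω => |Y ω| ^ (2 : ℝ)) μ :=
    hSY.comp (φ := fun x => |x| ^ (p - 2)) (ψ := fun x => |x| ^ (2 : ℝ)) (by fun_prop) (by fun_prop)
  have hlinear : ∫ ω, |S ω| ^ (p - 2) * S ω * Y ω ∂μ = 0 := by
    rw [hind1.integral_fun_mul_eq_mul_integral hS1.1 hY1.1, hY0, mul_zero]
  have hint1 : Integrable (fun ω => p * (|S ω| ^ (p - 2) * S ω * Y ω)) μ :=
    (hind1.integrable_mul hS1 hY1).const_mul p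
  have hint2 : Integrable (fun ω => |S ω| ^ (p - 2) * |Y ω| ^ (2 : ℝ)) μ :=
    hind2.integrable_mul hS2 hY2
  have hint3 : Integrable (fun ω => |S ω| ^ p + p * (|S ω| ^ (p - 2) * S ω * Y ω)) μ :=
    hSp.add hint1
  have hint4 : Integrable (fun ω => expansionConst p *
    (|S ω| ^ (p - 2) * |Y ω| ^ (2 : ℝ) + |Y ω| ^ p)) μ := (hint2.add hYp).const_mul _
  calc ∫ ω, |S ω + Y ω| ^ p ∂μ ≤ ∫ ω, (|S ω| ^ p + p * (|S ω| ^ (p - 2) * S ω * Y ω) +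
        expansionConst p * (|S ω| ^ (p - 2) * |Y ω| ^ (2 : ℝ) + |Y ω| ^ p)) ∂μ := by
        refine integral_mono (integrable_abs_rpow (by linarith) le_rfl (hS.add hY))
          (hint3.add hint4) fun ω => ?_
        simpa only [Real.rpow_two, sq_abs] using abs_add_rpow_le hp (S ω) (Y ω)
    _ = _ := by
        rw [integral_add hint3 hint4, integral_add hSp hint1,
          integral_const_mul, integral_const_mul, integral_add hint2 hYp, hlinear, mul_zero,
          add_zero, hind2.integral_fun_mul_eq_mul_integral hS2.1 hY2.1]

/-- The constant in the Marcinkiewicz–Zygmund inequality `integral_abs_sum_rpow_le`. -/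
def mzConst (p : ℝ) : ℝ := (2 * expansionConst p) ^ (p / 2)

lemma mzConst_pos {p : ℝ} (hp : 2 ≤ p) : 0 < mzConst p :=
  Real.rpow_pos_of_pos (by linarith [one_le_expansionConst hp]) _

lemma two_mul_expansionConst_le_mzConst {p : ℝ} (hp : 2 ≤ p) :
    2 * expansionConst p ≤ mzConst p :=
  Real.self_le_rpow_of_one_le (by linarith [one_le_expansionConst hp]) (by linarith)

lemma two_mul_expansionConst_mul_mzConst_rpow {p : ℝ} (hp : 2 ≤ p) :
    2 * expansionConst p * mzConst p ^ ((p - 2) / p) = mzConst p := by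
  have hc : 0 < 2 * expansionConst p := by linarith [one_le_expansionConst hp]
  rw [mzConst, ← Real.rpow_mul hc.le, ← Real.rpow_one_add' hc.le]
  · congr 1; field_simp; ring
  · have : 0 ≤ p / 2 * ((p - 2) / p) := by
      have := div_nonneg (sub_nonneg.2 hp) (by linarith : 0 ≤ p); positivity
    linarith

lemma rpow_half_add_le {p : ℝ} (hp : 2 ≤ p) (n : ℕ) :
    (n : ℝ) ^ (p / 2) + ((n : ℝ) ^ ((p - 2) / 2) + 1) / 2 ≤ ((n : ℝ) + 1) ^ (p / 2) := by
  have ht : 0 ≤ (p - 2) / 2 := by linarith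
  have hsplit : ∀ x : ℝ, 0 ≤ x → x ^ (p / 2) = x ^ ((p - 2) / 2) * x := fun x hx => by
    rw [← Real.rpow_add_one' hx (by linarith)]; ring_nf
  have hn : (0 : ℝ) ≤ n := n.cast_nonneg
  rw [hsplit _ hn, hsplit _ (by linarith)]
  have hmono : (n : ℝ) ^ ((p - 2) / 2) ≤ ((n : ℝ) + 1) ^ ((p - 2) / 2) := by gcongr; linarith
  have hone : 1 ≤ ((n : ℝ) + 1) ^ ((p - 2) / 2) := Real.one_le_rpow (by linarith) ht
  nlinarith [mul_le_mul_of_nonneg_right hmono hn]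

lemma integral_abs_rpow_mul_integral_sq_le [IsProbabilityMeasure μ] (hp : 2 ≤ p) {S Y : Ω → ℝ}
    {A β : ℝ} (hS : MemLp S (ENNReal.ofReal p) μ) (hY : MemLp Y (ENNReal.ofReal p) μ)
    (hA : ∫ ω, |S ω| ^ p ∂μ ≤ A) (hβ : ∫ ω, |Y ω| ^ p ∂μ ≤ β) :
    (∫ ω, |S ω| ^ (p - 2) ∂μ) * ∫ ω, |Y ω| ^ (2 : ℝ) ∂μ ≤ A ^ ((p - 2) / p) * β ^ (2 / p) := by
  have hp0 : 0 < p := by linarith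
  have hA0 : 0 ≤ A := (integral_nonneg fun ω => by positivity).trans hA
  refine mul_le_mul
    ((integral_abs_rpow_le_rpow (by linarith) (by linarith) hp0 hS).trans ?_)
    ((integral_abs_rpow_le_rpow two_pos.le hp hp0 hY).trans ?_)
    (integral_nonneg fun ω => by positivity) (by positivity)
  · exact Real.rpow_le_rpow (integral_nonneg fun ω => by positivity) hA
      (div_nonneg (by linarith) hp0.le)
  · exact Real.rpow_le_rpow (integral_nonneg fun ω => by positivity) hβ (by positivity)

lemma mzConst_mul_add_le (hp : 2 ≤ p) {β : ℝ} (hβ : 0 ≤ β) (n : ℕ) :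
    mzConst p * β * (n : ℝ) ^ (p / 2) + expansionConst p *
        ((mzConst p * β * (n : ℝ) ^ (p / 2)) ^ ((p - 2) / p) * β ^ (2 / p) + β) ≤
      mzConst p * β * ((n : ℝ) + 1) ^ (p / 2) := by
  have hp0 : p ≠ 0 := by linarith
  have hK := mzConst_pos hp
  have hexp : (p - 2) / p + 2 / p = 1 := by field_simp; ring
  have hpow : (mzConst p * β * (n : ℝ) ^ (p / 2)) ^ ((p - 2) / p) * β ^ (2 / p) =
      mzConst p ^ ((p - 2) / p) * β * (n : ℝ) ^ ((p - 2) / 2) := by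
    rw [Real.mul_rpow (by positivity) (by positivity), Real.mul_rpow hK.le hβ,
      ← Real.rpow_mul (by positivity), show p / 2 * ((p - 2) / p) = (p - 2) / 2 by field_simp]
    calc _ = mzConst p ^ ((p - 2) / p) * (β ^ ((p - 2) / p) * β ^ (2 / p)) *
          (n : ℝ) ^ ((p - 2) / 2) := by ring
      _ = _ := by rw [← Real.rpow_add' hβ (by rw [hexp]; exact one_ne_zero), hexp, Real.rpow_one]
  have hlow : 2 * expansionConst p * (mzConst p ^ ((p - 2) / p) * β * (n : ℝ) ^ ((p - 2) / 2)) =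
      mzConst p * β * (n : ℝ) ^ ((p - 2) / 2) := by
    rw [← mul_assoc, ← mul_assoc, two_mul_expansionConst_mul_mzConst_rpow hp]
  have hconst : 2 * expansionConst p * β ≤ mzConst p * β := by
    gcongr; exact two_mul_expansionConst_le_mzConst hp
  have hn : mzConst p * β * ((n : ℝ) ^ (p / 2) + ((n : ℝ) ^ ((p - 2) / 2) + 1) / 2) ≤
      mzConst p * β * ((n : ℝ) + 1) ^ (p / 2) := by gcongr; exact rpow_half_add_le hp n
  rw [hpow]
  linarith

/- The lower-order term `E |S| ^ (p - 2)` is controlled by the bound on `E |S| ^ p` itself, so no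
separate bound on the variance of `S` is carried through the induction. -/
theorem integral_abs_sum_rpow_le [IsProbabilityMeasure μ] {ι : Type*} {Y : ι → Ω → ℝ}
    (hmeas : ∀ i, Measurable (Y i)) (hind : iIndepFun Y μ) {β : ℝ} (hp : 2 ≤ p)
    (hY : ∀ i, MemLp (Y i) (ENNReal.ofReal p) μ) (hY0 : ∀ i, ∫ ω, Y i ω ∂μ = 0)
    (hβ : ∀ i, ∫ ω, |Y i ω| ^ p ∂μ ≤ β) (s : Finset ι) :
    ∫ ω, |∑ i ∈ s, Y i ω| ^ p ∂μ ≤ mzConst p * β * (s.card : ℝ) ^ (p / 2) := by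
  classical
  induction s using Finset.induction_on with
  | empty => simp [Real.zero_rpow (by linarith : p ≠ 0), Real.zero_rpow (by linarith : p / 2 ≠ 0)]
  | insert i s hi ih =>
    have hβ0 : 0 ≤ β := (integral_nonneg fun ω => by positivity).trans (hβ i)
    have hS : MemLp (fun ω => ∑ j ∈ s, Y j ω) (ENNReal.ofReal p) μ :=
      memLp_finsetSum s fun j _ => hY j
    have hSY : IndepFun (fun ω => ∑ j ∈ s, Y j ω) (Y i) μ := by
      simpa only [← Finset.sum_apply] using! hind.indepFun_finsetSum_of_notMem hmeas hi
    simp only [Finset.sum_insert hi, Finset.card_insert_of_notMem hi, Nat.cast_add, Nat.cast_one,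
      add_comm (Y i _)]
    refine (integral_abs_add_rpow_le hp hS (hY i) hSY (hY0 i)).trans
      (le_trans ?_ (mzConst_mul_add_le hp hβ0 s.card))
    exact add_le_add ih (mul_le_mul_of_nonneg_left
      (add_le_add (integral_abs_rpow_mul_integral_sq_le hp hS (hY i) ih (hβ i)) (hβ i))
      (by linarith [one_le_expansionConst hp]))

end MomentInequality

/-! ### Averages of independent copies -/

section Average

variable {α : Type*} [MeasurableSpace α] {ι ι' : Type*} [Fintype ι] [Fintype ι']

lemma measurePreserving_pi_comp (κ : Measure α) [IsProbabilityMeasure κ] {e : ι' → ι}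
    (he : Function.Injective e) :
    MeasurePreserving (fun (y : ι → α) i => y (e i)) (Measure.pi fun _ => κ)
      (Measure.pi fun _ => κ) := by
  refine ⟨by fun_prop, ?_⟩
  have hind : iIndepFun (fun i (y : ι → α) => y i) (Measure.pi fun _ => κ) :=
    iIndepFun_pi (X := fun _ => id) fun _ => aemeasurable_id
  rw [(iIndepFun_iff_map_fun_eq_pi_map
    (fun i => (measurable_pi_apply (e i)).aemeasurable)).1 (hind.precomp he)]
  congr 1
  ext1 i
  exact (measurePreserving_eval (fun _ => κ) (e i)).map_eq

lemma memLp_of_lintegral_abs_rpow_lt_top {μ : Measure α} {g : α → ℝ} {p : ℝ} (hp : 0 < p)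
    (hg : AEStronglyMeasurable g μ) (h : ∫⁻ z, ENNReal.ofReal (|g z| ^ p) ∂μ < ⊤) :
    MemLp g (ENNReal.ofReal p) μ := by
  refine ⟨hg, ?_⟩
  rw [eLpNorm_lt_top_iff_lintegral_rpow_enorm_lt_top (by simpa using hp) ENNReal.ofReal_ne_top,
    ENNReal.toReal_ofReal hp.le]
  simpa only [Real.enorm_eq_ofReal_abs, ENNReal.ofReal_rpow_of_nonneg (abs_nonneg _) hp.le] using h

variable {κ : Measure α} [IsProbabilityMeasure κ] {g : α → ℝ} {p : ℝ}

lemma integral_abs_sub_integral_rpow_le (hp : 1 ≤ p) (hg : MemLp g (ENNReal.ofReal p) κ) :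
    ∫ z, |g z - ∫ w, g w ∂κ| ^ p ∂κ ≤ 2 ^ (p + 1) * ∫ z, |g z| ^ p ∂κ := by
  set u := ∫ w, g w ∂κ
  have hp0 : 0 < p := one_pos.trans_le hp
  have hpow := integrable_abs_rpow hp0.le le_rfl hg
  have hB : 0 ≤ ∫ z, |g z| ^ p ∂κ := integral_nonneg fun _ => by positivity
  have hu : |u| ^ p ≤ ∫ z, |g z| ^ p ∂κ := by
    have hL1 := integral_abs_rpow_le_rpow zero_le_one hp hp0 hg
    simp only [Real.rpow_one] at hL1
    calc |u| ^ p ≤ ((∫ z, |g z| ^ p ∂κ) ^ (1 / p)) ^ p := by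
          gcongr; exact abs_integral_le_integral_abs.trans hL1
      _ = ∫ z, |g z| ^ p ∂κ := by
          rw [← Real.rpow_mul hB, one_div_mul_cancel hp0.ne', Real.rpow_one]
  calc ∫ z, |g z - u| ^ p ∂κ ≤ ∫ z, 2 ^ p * (|g z| ^ p + |u| ^ p) ∂κ := by
        refine integral_mono_of_nonneg (ae_of_all _ fun _ => by positivity)
          ((hpow.add (integrable_const _)).const_mul _) (ae_of_all _ fun z => ?_)
        calc |g z - u| ^ p ≤ (|g z| + |u|) ^ p := by gcongr; exact abs_sub _ _
          _ ≤ _ := add_rpow_le_two_rpow_mul hp0.le (abs_nonneg _) (abs_nonneg _)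
    _ = 2 ^ p * (∫ z, |g z| ^ p ∂κ + |u| ^ p) := by
        rw [integral_const_mul, integral_add hpow (integrable_const _), integral_const,
          probReal_univ, one_smul]
    _ ≤ 2 ^ p * (∫ z, |g z| ^ p ∂κ + ∫ z, |g z| ^ p ∂κ) := by gcongr
    _ = _ := by rw [Real.rpow_add_one two_ne_zero]; ring

/-- The constant in the moment bound for averages of independent copies. -/
def averageConst (p : ℝ) : ℝ := 2 ^ (p + 1) * mzConst p

lemma averageConst_pos (hp : 2 ≤ p) : 0 < averageConst p :=
  mul_pos (by positivity) (mzConst_pos hp)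

lemma sum_div_card_sub_eq [Nonempty ι] (x : ι → ℝ) (u : ℝ) :
    (∑ i, x i) / Fintype.card ι - u = (Fintype.card ι : ℝ)⁻¹ * ∑ i, (x i - u) := by
  have : (Fintype.card ι : ℝ) ≠ 0 := by positivity
  rw [Finset.sum_sub_distrib, Finset.sum_const, Finset.card_univ, nsmul_eq_mul]
  field_simp

lemma memLp_average_sub {q : ENNReal} (hg : MemLp g q κ) (u : ℝ) :
    MemLp (fun y : ι → α => (∑ i, g (y i)) / Fintype.card ι - u) q (Measure.pi fun _ => κ) := by
  refine MemLp.sub ?_ (memLp_const u)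
  simp only [div_eq_mul_inv]
  exact (memLp_finsetSum _ fun i _ =>
    hg.comp_measurePreserving (measurePreserving_eval (fun _ => κ) i)).mul_const _

lemma integral_abs_average_sub_rpow_le [Nonempty ι] (hgm : Measurable g) (hp : 2 ≤ p)
    (hg : MemLp g (ENNReal.ofReal p) κ) :
    ∫ y : ι → α, |(∑ i, g (y i)) / Fintype.card ι - ∫ w, g w ∂κ| ^ p ∂(Measure.pi fun _ => κ) ≤
      averageConst p * (Fintype.card ι : ℝ) ^ (-(p / 2)) * ∫ z, |g z| ^ p ∂κ := by
  set u := ∫ w, g w ∂κ with hu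
  have hp1 : 1 ≤ p := one_le_two.trans hp
  have hN : 0 < (Fintype.card ι : ℝ) := by positivity
  have hev (i : ι) : MeasurePreserving (fun y : ι → α => y i) (Measure.pi fun _ => κ) κ :=
    measurePreserving_eval (fun _ => κ) i
  have hcomp (i : ι) {F : α → ℝ} (hF : Measurable F) :
      ∫ y : ι → α, F (y i) ∂(Measure.pi fun _ => κ) = ∫ z, F z ∂κ := by
    simpa only [(hev i).map_eq] using
      (integral_map (hev i).aemeasurable hF.aestronglyMeasurable).symm
  have hsub : MemLp (fun z => g z - u) (ENNReal.ofReal p) κ := hg.sub (memLp_const u)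
  have hsum := integral_abs_sum_rpow_le (Y := fun (i : ι) (y : ι → α) => g (y i) - u)
    (β := 2 ^ (p + 1) * ∫ z, |g z| ^ p ∂κ)
    (fun i => by fun_prop) (iIndepFun_pi (X := fun _ z => g z - u) fun _ => by fun_prop) hp
    (fun i => hsub.comp_measurePreserving (hev i))
    (fun i => by
      rw [hcomp i (F := fun z => g z - u) (by fun_prop), integral_sub
        (hg.integrable (by simpa using hp1)) (integrable_const _)]
      simp [hu])
    (fun i => by
      rw [hcomp i (F := fun z => |g z - u| ^ p) (by fun_prop)]
      exact integral_abs_sub_integral_rpow_le hp1 hg) Finset.univ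
  simp only [sum_div_card_sub_eq, abs_mul, Real.mul_rpow (abs_nonneg _) (abs_nonneg _),
    integral_const_mul]
  rw [abs_of_pos (inv_pos.2 hN), Real.inv_rpow hN.le, ← Real.rpow_neg hN.le]
  rw [Finset.card_univ] at hsum
  calc _ ≤ (Fintype.card ι : ℝ) ^ (-p) * (mzConst p * (2 ^ (p + 1) * ∫ z, |g z| ^ p ∂κ) *
        (Fintype.card ι : ℝ) ^ (p / 2)) := by gcongr
    _ = averageConst p * ((Fintype.card ι : ℝ) ^ (-p) * (Fintype.card ι : ℝ) ^ (p / 2)) *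
        ∫ z, |g z| ^ p ∂κ := by rw [averageConst]; ring
    _ = _ := by rw [← Real.rpow_add hN]; ring_nf

lemma lintegral_abs_average_sub_rpow_le [Nonempty ι] (hgm : Measurable g) (hp : 2 ≤ p) :
    ∫⁻ y : ι → α, ENNReal.ofReal (|(∑ i, g (y i)) / Fintype.card ι - ∫ w, g w ∂κ| ^ p)
        ∂(Measure.pi fun _ => κ) ≤
      ENNReal.ofReal (averageConst p * (Fintype.card ι : ℝ) ^ (-(p / 2))) *
        ∫⁻ z, ENNReal.ofReal (|g z| ^ p) ∂κ := by
  have hp0 : 0 < p := two_pos.trans_le hp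
  have hc : 0 < averageConst p * (Fintype.card ι : ℝ) ^ (-(p / 2)) :=
    mul_pos (averageConst_pos hp) (by positivity)
  by_cases htop : ∫⁻ z, ENNReal.ofReal (|g z| ^ p) ∂κ = ⊤
  · simp [htop, ENNReal.mul_top, hc]
  have hg : MemLp g (ENNReal.ofReal p) κ :=
    memLp_of_lintegral_abs_rpow_lt_top hp0 hgm.aestronglyMeasurable (lt_top_iff_ne_top.2 htop)
  rw [← ofReal_integral_eq_lintegral_ofReal
      (integrable_abs_rpow hp0.le le_rfl (memLp_average_sub hg _))
      (ae_of_all _ fun _ => by positivity),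
    ← ofReal_integral_eq_lintegral_ofReal (integrable_abs_rpow hp0.le le_rfl hg)
      (ae_of_all _ fun _ => by positivity), ← ENNReal.ofReal_mul hc.le]
  exact ENNReal.ofReal_le_ofReal (integral_abs_average_sub_rpow_le hgm hp hg)

end Average

/-! ### Antithetic differences -/

section Delta

/-- The indices of the entries that `delta (n + 1)` sums in its first half-sample. -/
def evenIdx (n : ℕ) (i : Fin (2 ^ n)) : Fin (2 ^ (n + 1)) :=
  ⟨2 * i, by have := i.2; rw [pow_succ]; omega⟩

/-- The indices of the entries that `delta (n + 1)` sums in its second half-sample. -/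
def oddIdx (n : ℕ) (i : Fin (2 ^ n)) : Fin (2 ^ (n + 1)) :=
  ⟨2 * i + 1, by have := i.2; rw [pow_succ]; omega⟩

lemma evenIdx_injective (n : ℕ) : Function.Injective (evenIdx n) := fun i j h => by
  simp only [evenIdx, Fin.mk.injEq] at h; ext; omega

lemma oddIdx_injective (n : ℕ) : Function.Injective (oddIdx n) := fun i j h => by
  simp only [oddIdx, Fin.mk.injEq] at h; ext; omega

lemma sum_evenIdx_add_sum_oddIdx (n : ℕ) (y : Fin (2 ^ (n + 1)) → ℝ) :
    (∑ i, y (evenIdx n i)) + ∑ i, y (oddIdx n i) = ∑ i, y i := by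
  rw [← Fintype.sum_sumElim]
  refine Fintype.sum_bijective (Sum.elim (evenIdx n) (oddIdx n)) ?_ _ _ ?_
  · rw [Fintype.bijective_iff_injective_and_card]
    refine ⟨(evenIdx_injective n).sumElim (oddIdx_injective n) fun i j h => ?_, ?_⟩
    · simp only [evenIdx, oddIdx, Fin.mk.injEq] at h; omega
    · simp [pow_succ, mul_two]
  · rintro (i | i) <;> rfl

lemma delta_succ (n : ℕ) (a : ℝ) (y : Fin (2 ^ (n + 1)) → ℝ) :
    delta (n + 1) a y = max a ((∑ i, y i) / 2 ^ (n + 1)) -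
      1 / 2 * (max a ((∑ i, y (evenIdx n i)) / 2 ^ n) +
        max a ((∑ i, y (oddIdx n i)) / 2 ^ n)) := rfl

lemma delta_succ_eq_midpoint (n : ℕ) (a : ℝ) (y : Fin (2 ^ (n + 1)) → ℝ) :
    delta (n + 1) a y =
      max a (((∑ i, y (evenIdx n i)) / 2 ^ n + (∑ i, y (oddIdx n i)) / 2 ^ n) / 2) -
      1 / 2 * (max a ((∑ i, y (evenIdx n i)) / 2 ^ n) +
        max a ((∑ i, y (oddIdx n i)) / 2 ^ n)) := by
  rw [delta_succ, ← sum_evenIdx_add_sum_oddIdx, ← add_div, div_div, ← pow_succ]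

lemma abs_max_midpoint_sub_le (a u x y : ℝ) :
    |max a ((x + y) / 2) - 1 / 2 * (max a x + max a y)| ≤ max |x - u| |y - u| := by
  have h1 := le_max_left |x - u| |y - u|
  have h2 := le_max_right |x - u| |y - u|
  generalize max |x - u| |y - u| = M at *
  rw [abs_le] at *
  rcases max_cases a x with ⟨e1, _⟩ | ⟨e1, _⟩ <;> rcases max_cases a y with ⟨e2, _⟩ | ⟨e2, _⟩ <;>
    rcases max_cases a ((x + y) / 2) with ⟨e3, _⟩ | ⟨e3, _⟩ <;> rw [e1, e2, e3] <;>
    constructor <;> linarith [h1.1, h1.2, h2.1, h2.2]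

lemma max_midpoint_sub_eq_zero {a u x y : ℝ} (h : max |x - u| |y - u| < |u - a|) :
    max a ((x + y) / 2) - 1 / 2 * (max a x + max a y) = 0 := by
  obtain ⟨h1, h2⟩ := max_lt_iff.1 h
  rw [abs_lt] at h1 h2
  rcases le_total u a with hu | hu
  · rw [abs_of_nonpos (by linarith)] at h1 h2
    rw [max_eq_left (by linarith), max_eq_left (by linarith), max_eq_left (by linarith)]; ring
  · rw [abs_of_nonneg (by linarith)] at h1 h2
    rw [max_eq_right (by linarith), max_eq_right (by linarith), max_eq_right (by linarith)]; ring

variable {p q s ε : ℝ}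

lemma rpow_le_rpow_sub_mul_rpow {M : ℝ} (hqp : q ≤ p) (hs : 0 < s) (hM : s ≤ M) :
    M ^ q ≤ s ^ (q - p) * M ^ p := by
  calc M ^ q = M ^ (q - p) * M ^ p := by rw [← Real.rpow_add (hs.trans_le hM)]; congr 1; ring
    _ ≤ s ^ (q - p) * M ^ p := mul_le_mul_of_nonneg_right
        (Real.rpow_le_rpow_of_nonpos hs hM (by linarith)) (Real.rpow_nonneg (hs.le.trans hM) _)

lemma rpow_le_add_indicator {t M D : ℝ} (hq : 0 < q) (hqp : q ≤ p) (hs : 0 < s) (hε : 0 < ε)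
    (ht : 0 ≤ t) (htM : t ≤ M) (hD : M < D → t = 0) :
    t ^ q ≤ (s ^ (q - p) + ε ^ (q - p)) * M ^ p + (Set.Iio ε).indicator (fun _ => s ^ q) D := by
  have hM : 0 ≤ M := ht.trans htM
  have hind : 0 ≤ (Set.Iio ε).indicator (fun _ => s ^ q) D :=
    Set.indicator_nonneg (fun _ _ => by positivity) _
  have htq : t ^ q ≤ M ^ q := Real.rpow_le_rpow ht htM hq.le
  have hsM : 0 ≤ s ^ (q - p) * M ^ p := by positivity
  have hεM : 0 ≤ ε ^ (q - p) * M ^ p := by positivity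
  rw [add_mul]
  rcases lt_or_ge M D with h | h
  · rw [hD h, Real.zero_rpow hq.ne']; positivity
  rcases lt_or_ge D ε with hDε | hDε
  · rw [Set.indicator_of_mem (by exact hDε)]
    rcases le_total s M with h | h
    · linarith [rpow_le_rpow_sub_mul_rpow hqp hs h, Real.rpow_nonneg hs.le q]
    · linarith [Real.rpow_le_rpow hM h hq.le]
  · linarith [rpow_le_rpow_sub_mul_rpow hqp hε (hDε.trans h)]

/- The difference vanishes when the half-sample averages are on the same side of `a`, which they are
when both are closer to `u` than `a` is. -/
lemma abs_delta_succ_rpow_le (hq : 0 < q) (hqp : q ≤ p) (hs : 0 < s) (hε : 0 < ε) (n : ℕ)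
    (a u : ℝ) (y : Fin (2 ^ (n + 1)) → ℝ) :
    |delta (n + 1) a y| ^ q ≤ (s ^ (q - p) + ε ^ (q - p)) *
        (|(∑ i, y (evenIdx n i)) / 2 ^ n - u| ^ p + |(∑ i, y (oddIdx n i)) / 2 ^ n - u| ^ p) +
      (Set.Iio ε).indicator (fun _ => s ^ q) |u - a| := by
  rw [delta_succ_eq_midpoint]
  set x := (∑ i, y (evenIdx n i)) / 2 ^ n
  set x' := (∑ i, y (oddIdx n i)) / 2 ^ n
  refine (rpow_le_add_indicator (p := p) (D := |u - a|) hq hqp hs hε (abs_nonneg _)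
    (abs_max_midpoint_sub_le a u x x')
    fun h => by rw [max_midpoint_sub_eq_zero h, abs_zero]).trans ?_
  gcongr
  exact max_rpow_le_add (abs_nonneg _) (abs_nonneg _)

variable {α : Type*} [MeasurableSpace α] {κ : Measure α} [IsProbabilityMeasure κ] {g : α → ℝ}

lemma lintegral_abs_average_comp_sub_rpow_le (hg : Measurable g) (hp : 2 ≤ p) {n : ℕ}
    {e : Fin (2 ^ n) → Fin (2 ^ (n + 1))} (he : Function.Injective e) :
    ∫⁻ y : Fin (2 ^ (n + 1)) → α, ENNReal.ofReal (|(∑ i, g (y (e i))) / 2 ^ n - ∫ w, g w ∂κ| ^ p)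
        ∂(Measure.pi fun _ => κ) ≤
      ENNReal.ofReal (averageConst p * ((2 : ℝ) ^ n) ^ (-(p / 2))) *
        ∫⁻ z, ENNReal.ofReal (|g z| ^ p) ∂κ := by
  have h := lintegral_abs_average_sub_rpow_le (ι := Fin (2 ^ n)) (κ := κ) hg hp
  simp only [Fintype.card_fin, Nat.cast_pow, Nat.cast_ofNat] at h
  rwa [← (measurePreserving_pi_comp κ he).lintegral_comp (by fun_prop)] at h

lemma lintegral_abs_delta_succ_rpow_le (hg : Measurable g) (hp : 2 ≤ p) (hq : 0 < q) (hqp : q ≤ p)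
    (hs : 0 < s) (hε : 0 < ε) (n : ℕ) (a : ℝ) :
    ∫⁻ y : Fin (2 ^ (n + 1)) → α, ENNReal.ofReal (|delta (n + 1) a fun i => g (y i)| ^ q)
        ∂(Measure.pi fun _ => κ) ≤
      ENNReal.ofReal ((s ^ (q - p) + ε ^ (q - p)) *
          (2 * averageConst p * ((2 : ℝ) ^ n) ^ (-(p / 2)))) *
        ∫⁻ z, ENNReal.ofReal (|g z| ^ p) ∂κ +
      (Set.Iio ε).indicator (fun _ => ENNReal.ofReal (s ^ q)) |(∫ z, g z ∂κ) - a| := by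
  set u := ∫ z, g z ∂κ
  set A := averageConst p * ((2 : ℝ) ^ n) ^ (-(p / 2))
  have hc : 0 ≤ s ^ (q - p) + ε ^ (q - p) := by positivity
  have hA0 : 0 ≤ A := mul_nonneg (averageConst_pos hp).le (by positivity)
  have hind : (Set.Iio ε).indicator (fun _ => ENNReal.ofReal (s ^ q)) |u - a| =
      ENNReal.ofReal ((Set.Iio ε).indicator (fun _ => s ^ q) |u - a|) := by
    by_cases h : |u - a| ∈ Set.Iio ε <;> simp [h]
  have hpt (y : Fin (2 ^ (n + 1)) → α) :
      ENNReal.ofReal (|delta (n + 1) a fun i => g (y i)| ^ q) ≤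
      ENNReal.ofReal (s ^ (q - p) + ε ^ (q - p)) *
        (ENNReal.ofReal (|(∑ i, g (y (evenIdx n i))) / 2 ^ n - u| ^ p) +
          ENNReal.ofReal (|(∑ i, g (y (oddIdx n i))) / 2 ^ n - u| ^ p)) +
        (Set.Iio ε).indicator (fun _ => ENNReal.ofReal (s ^ q)) |u - a| := by
    rw [hind, ← ENNReal.ofReal_add (by positivity) (by positivity), ← ENNReal.ofReal_mul hc,
      ← ENNReal.ofReal_add (by positivity) (Set.indicator_nonneg (fun _ _ => by positivity) _)]
    exact ENNReal.ofReal_le_ofReal (abs_delta_succ_rpow_le hq hqp hs hε n a u fun i => g (y i))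
  refine (lintegral_mono hpt).trans ?_
  rw [lintegral_add_right _ measurable_const, lintegral_const_mul _ (by fun_prop),
    lintegral_add_left (by fun_prop), lintegral_const, measure_univ, mul_one, ENNReal.ofReal_mul hc,
    mul_assoc, mul_assoc (2 : ℝ), two_mul, ENNReal.ofReal_add hA0 hA0, add_mul]
  gcongr
  · exact lintegral_abs_average_comp_sub_rpow_le hg hp (evenIdx_injective n)
  · exact lintegral_abs_average_comp_sub_rpow_le hg hp (oddIdx_injective n)

/-- The mean of the maximum of `a` and the average of `2 ^ n` independent copies of `g`. -/
def meanMax (κ : Measure α) (g : α → ℝ) (a : ℝ) (n : ℕ) : ℝ :=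
  ∫ y : Fin (2 ^ n) → α, max a ((∑ i, g (y i)) / 2 ^ n) ∂(Measure.pi fun _ => κ)

lemma integrable_max_average (hg : Integrable g κ) (a : ℝ) (n : ℕ) :
    Integrable (fun y : Fin (2 ^ n) → α => max a ((∑ i, g (y i)) / 2 ^ n))
      (Measure.pi fun _ => κ) := by
  refine (integrable_const a).sup (Integrable.div_const (integrable_finsetSum _ fun i _ => ?_) _)
  exact (measurePreserving_eval (fun _ => κ) i).integrable_comp_of_integrable hg

lemma integral_delta_zero (κ : Measure α) (g : α → ℝ) (a : ℝ) :
    ∫ y : Fin (2 ^ 0) → α, delta 0 a (fun i => g (y i)) ∂(Measure.pi fun _ => κ) =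
      meanMax κ g a 0 := by
  refine integral_congr_ae (ae_of_all _ fun y => ?_)
  change max a (g (y 0)) = max a ((∑ i : Fin 1, g (y i)) / 2 ^ 0)
  simp

lemma integrable_max_average_comp (hg : Integrable g κ) (a : ℝ) {n : ℕ}
    {e : Fin (2 ^ n) → Fin (2 ^ (n + 1))} (he : Function.Injective e) :
    Integrable (fun y : Fin (2 ^ (n + 1)) → α => max a ((∑ i, g (y (e i))) / 2 ^ n))
      (Measure.pi fun _ => κ) :=
  (measurePreserving_pi_comp κ he).integrable_comp_of_integrable (integrable_max_average hg a n)

lemma integral_max_average_comp (hg : Integrable g κ) (a : ℝ) {n : ℕ}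
    {e : Fin (2 ^ n) → Fin (2 ^ (n + 1))} (he : Function.Injective e) :
    ∫ y : Fin (2 ^ (n + 1)) → α, max a ((∑ i, g (y (e i))) / 2 ^ n) ∂(Measure.pi fun _ => κ) =
      meanMax κ g a n := by
  have hm := measurePreserving_pi_comp κ he
  have hmeas := hm.map_eq.symm ▸ (integrable_max_average hg a n).aestronglyMeasurable
  rw [meanMax, ← hm.map_eq, integral_map hm.aemeasurable hmeas]

lemma integral_delta_succ (hg : Integrable g κ) (a : ℝ) (n : ℕ) :
    ∫ y : Fin (2 ^ (n + 1)) → α, delta (n + 1) a (fun i => g (y i)) ∂(Measure.pi fun _ => κ) =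
      meanMax κ g a (n + 1) - meanMax κ g a n := by
  have heven := integrable_max_average_comp hg a (evenIdx_injective n)
  have hodd := integrable_max_average_comp hg a (oddIdx_injective n)
  have hadd : Integrable (fun y : Fin (2 ^ (n + 1)) → α =>
      max a ((∑ i, g (y (evenIdx n i))) / 2 ^ n) + max a ((∑ i, g (y (oddIdx n i))) / 2 ^ n))
      (Measure.pi fun _ => κ) := heven.add hodd
  simp only [delta_succ]
  rw [integral_sub (integrable_max_average hg a (n + 1)) (hadd.const_mul (1 / 2)),
    integral_const_mul, integral_add heven hodd, integral_max_average_comp hg a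
    (evenIdx_injective n), integral_max_average_comp hg a (oddIdx_injective n)]
  change meanMax κ g a (n + 1) - _ = _
  ring

lemma sum_range_integral_delta (hg : Integrable g κ) (a : ℝ) (n : ℕ) :
    ∑ j ∈ Finset.range (n + 1), ∫ y : Fin (2 ^ j) → α, delta j a (fun i => g (y i))
      ∂(Measure.pi fun _ => κ) = meanMax κ g a n := by
  induction n with
  | zero => rw [zero_add, Finset.sum_range_one, integral_delta_zero]
  | succ n ih => rw [Finset.sum_range_succ, ih, integral_delta_succ hg]; ring

lemma abs_meanMax_sub_le (hgm : Measurable g) (hg : MemLp g 2 κ) (a : ℝ) (n : ℕ) :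
    |meanMax κ g a n - max a (∫ z, g z ∂κ)| ≤
      (averageConst 2 * (∫ z, |g z| ^ (2 : ℝ) ∂κ) * 2⁻¹ ^ n) ^ (1 / 2 : ℝ) := by
  set u := ∫ z, g z ∂κ with hu
  have hg' : MemLp g (ENNReal.ofReal 2) κ := by simpa using hg
  have hgi : Integrable g κ := hg.integrable one_le_two
  have hsub : MemLp (fun y : Fin (2 ^ n) → α => (∑ i, g (y i)) / 2 ^ n - u) (ENNReal.ofReal 2)
      (Measure.pi fun _ => κ) := by
    simpa using memLp_average_sub (ι := Fin (2 ^ n)) hg u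
  have hL1 := integral_abs_rpow_le_rpow zero_le_one one_le_two two_pos hsub
  have hL2 := integral_abs_average_sub_rpow_le (ι := Fin (2 ^ n)) hgm le_rfl hg'
  simp only [Fintype.card_fin, Nat.cast_pow, Nat.cast_ofNat, ← hu, div_self (two_ne_zero' ℝ),
    Real.rpow_neg_one] at hL2
  simp only [Real.rpow_one] at hL1
  have hconst : max a u = ∫ _ : Fin (2 ^ n) → α, max a u ∂(Measure.pi fun _ => κ) := by simp
  rw [meanMax, hconst, ← integral_sub (integrable_max_average hgi a n) (integrable_const _)]
  calc _ ≤ ∫ y : Fin (2 ^ n) → α, |max a ((∑ i, g (y i)) / 2 ^ n) - max a u|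
        ∂(Measure.pi fun _ => κ) := abs_integral_le_integral_abs
    _ ≤ ∫ y : Fin (2 ^ n) → α, |(∑ i, g (y i)) / 2 ^ n - u| ∂(Measure.pi fun _ => κ) := by
        refine integral_mono ((integrable_max_average hgi a n).sub (integrable_const _)).abs
          (hsub.integrable (by simp)).abs fun y => ?_
        exact (abs_max_sub_max_le_max a _ a u).trans (by simp)
    _ ≤ (averageConst 2 * (2 ^ n)⁻¹ * ∫ z, |g z| ^ (2 : ℝ) ∂κ) ^ (1 / 2 : ℝ) := by
        refine hL1.trans (Real.rpow_le_rpow (integral_nonneg fun _ => by positivity) hL2 ?_)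
        norm_num
    _ = _ := by rw [inv_pow]; ring_nf

open Filter Topology in
lemma tendsto_meanMax (hgm : Measurable g) (hg : MemLp g 2 κ) (a : ℝ) :
    Tendsto (meanMax κ g a) atTop (𝓝 (max a (∫ z, g z ∂κ))) := by
  refine tendsto_iff_dist_tendsto_zero.2
    (squeeze_zero (fun _ => dist_nonneg) (abs_meanMax_sub_le hgm hg a) ?_)
  have hgeo : Tendsto (fun n : ℕ => (2⁻¹ : ℝ) ^ n) atTop (𝓝 0) :=
    tendsto_pow_atTop_nhds_zero_of_lt_one (by norm_num) (by norm_num)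
  simpa using (hgeo.const_mul (averageConst 2 * ∫ z, |g z| ^ (2 : ℝ) ∂κ)).rpow_const
    (p := 1 / 2) (Or.inr (by norm_num))

lemma hasSum_integral_delta (hgm : Measurable g) (hg : MemLp g 2 κ) (a : ℝ)
    (hsum : Summable fun n => ∫ y : Fin (2 ^ n) → α, delta n a (fun i => g (y i))
      ∂(Measure.pi fun _ => κ)) :
    HasSum (fun n => ∫ y : Fin (2 ^ n) → α, delta n a (fun i => g (y i))
      ∂(Measure.pi fun _ => κ)) (max a (∫ z, g z ∂κ)) := by
  have hpartial := (Filter.tendsto_add_atTop_iff_nat 1).2 hsum.hasSum.tendsto_sum_nat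
  simp only [sum_range_integral_delta (hg.integrable one_le_two)] at hpartial
  rw [← tendsto_nhds_unique hpartial (tendsto_meanMax hgm hg a)]
  exact hsum.hasSum

end Delta

/-! ### Levels along a random history -/

section Level

variable {α β : Type*} [MeasurableSpace α] [MeasurableSpace β] {ν : Measure β} {K : Kernel β α}
  [IsMarkovKernel K] {g : α → ℝ} {a : β → ℝ} {p q C : ℝ}

/-- The rate of decay of the `q`-th moment of the antithetic differences: up to a constant, that of
`Δ_n` is at most `2 ^ (- n * levelDecay p q)` when the samples have a finite `p`-th moment. -/
def levelDecay (p q : ℝ) : ℝ := q / 2 + (p - q) / (4 * p)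

/-- The size up to which the `q`-th moment of `Δ_n` is estimated trivially, chosen together with
`levelGap` to balance the two sources of error. -/
def levelTruncation (p : ℝ) (n : ℕ) : ℝ := 2 ^ (-(n * (1 / 2 - 1 / (4 * p))))

/-- The distance of the mean from the kink of the maximum below which no cancellation is expected
in `Δ_n`. -/
def levelGap (n : ℕ) : ℝ := 2 ^ (-(n / 4 : ℝ))

lemma levelTruncation_rpow_mul_levelGap (hp : p ≠ 0) (q : ℝ) (n : ℕ) :
    levelTruncation p n ^ q * levelGap n = 2 ^ (-(n * levelDecay p q)) := by
  rw [levelTruncation, levelGap, ← Real.rpow_mul two_pos.le, ← Real.rpow_add two_pos, levelDecay]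
  congr 1
  field_simp
  ring

lemma levelTruncation_rpow_mul_rpow_eq (hp : p ≠ 0) (q : ℝ) (n : ℕ) :
    levelTruncation p n ^ (q - p) * ((2 : ℝ) ^ n) ^ (-(p / 2)) = 2 ^ (-(n * levelDecay p q)) := by
  rw [levelTruncation, ← Real.rpow_mul two_pos.le, ← Real.rpow_natCast, ← Real.rpow_mul two_pos.le,
    ← Real.rpow_add two_pos, levelDecay]
  congr 1
  field_simp
  ring

lemma levelGap_rpow_mul_rpow_le (hp : 1 ≤ p) (hqp : q ≤ p) (n : ℕ) :
    levelGap n ^ (q - p) * ((2 : ℝ) ^ n) ^ (-(p / 2)) ≤ 2 ^ (-(n * levelDecay p q)) := by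
  rw [levelGap, ← Real.rpow_mul two_pos.le, ← Real.rpow_natCast, ← Real.rpow_mul two_pos.le,
    ← Real.rpow_add two_pos, levelDecay]
  refine Real.rpow_le_rpow_of_exponent_le one_le_two ?_
  have hdiv : (p - q) / (4 * p) ≤ (p - q) / 4 :=
    div_le_div_of_nonneg_left (by linarith) (by norm_num) (by linarith)
  have := mul_le_mul_of_nonneg_left hdiv n.cast_nonneg
  linarith

lemma levelFactor_le (hp : 2 ≤ p) (hqp : q ≤ p) (n : ℕ) :
    (levelTruncation p n ^ (q - p) + levelGap n ^ (q - p)) *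
        (2 * averageConst p * ((2 : ℝ) ^ n) ^ (-(p / 2))) ≤
      2 ^ (-(n * levelDecay p q)) * (4 * averageConst p) := by
  have hc := averageConst_pos hp
  calc _ = 2 * averageConst p * (levelTruncation p n ^ (q - p) * ((2 : ℝ) ^ n) ^ (-(p / 2)) +
        levelGap n ^ (q - p) * ((2 : ℝ) ^ n) ^ (-(p / 2))) := by ring
    _ ≤ 2 * averageConst p * (2 ^ (-(n * levelDecay p q)) + 2 ^ (-(n * levelDecay p q))) := by
        gcongr
        · exact (levelTruncation_rpow_mul_rpow_eq (by linarith) q n).le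
        · exact levelGap_rpow_mul_rpow_le (by linarith) hqp n
    _ = _ := by ring

lemma measurable_delta_comp (hg : Measurable g) (n : ℕ) :
    Measurable fun w : ℝ × (Fin (2 ^ n) → α) => delta n w.1 fun i => g (w.2 i) :=
  (measurable_delta n).comp (f := fun w : ℝ × (Fin (2 ^ n) → α) => (w.1, fun i => g (w.2 i)))
    (by fun_prop)

lemma lintegral_abs_delta_succ_rpow_le_of_regular (hg : Measurable g) (ha : Measurable a)
    (hp : 2 ≤ p) (hq : 0 < q) (hqp : q ≤ p)
    (hC : ∀ ε > 0, ν {h | |(∫ z, g z ∂K h) - a h| < ε} ≤ ENNReal.ofReal (C * ε)) (n : ℕ) :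
    ∫⁻ h, ∫⁻ y : Fin (2 ^ (n + 1)) → α, ENNReal.ofReal (|delta (n + 1) (a h) fun i => g (y i)| ^ q)
        ∂Measure.pi (fun _ => K h) ∂ν ≤
      ENNReal.ofReal (2 ^ (-(n * levelDecay p q))) * (ENNReal.ofReal (4 * averageConst p) *
        ∫⁻ h, ∫⁻ z, ENNReal.ofReal (|g z| ^ p) ∂K h ∂ν + ENNReal.ofReal C) := by
  have hs : 0 < levelTruncation p n := Real.rpow_pos_of_pos two_pos _
  have hε : 0 < levelGap n := Real.rpow_pos_of_pos two_pos _
  have hdist : Measurable fun h => |(∫ z, g z ∂K h) - a h| :=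
    (hg.stronglyMeasurable.integral_kernel.measurable.sub ha).abs
  have hmoment : Measurable fun h => ∫⁻ z, ENNReal.ofReal (|g z| ^ p) ∂K h :=
    (hg.abs.pow_const p).ennreal_ofReal.lintegral_kernel
  have hnear : ∫⁻ h, (Set.Iio (levelGap n)).indicator
      (fun _ => ENNReal.ofReal (levelTruncation p n ^ q)) |(∫ z, g z ∂K h) - a h| ∂ν ≤
      ENNReal.ofReal (2 ^ (-(n * levelDecay p q))) * ENNReal.ofReal C := by
    calc _ = ENNReal.ofReal (levelTruncation p n ^ q) *
          ν {h | |(∫ z, g z ∂K h) - a h| < levelGap n} :=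
          lintegral_indicator_const (hdist measurableSet_Iio) _
      _ ≤ ENNReal.ofReal (levelTruncation p n ^ q) * ENNReal.ofReal (C * levelGap n) := by
          gcongr; exact hC _ hε
      _ = _ := by
          rw [← levelTruncation_rpow_mul_levelGap (by linarith), mul_comm C,
            ENNReal.ofReal_mul hε.le, ENNReal.ofReal_mul (Real.rpow_nonneg hs.le q), mul_assoc]
  calc _ ≤ ∫⁻ h, (ENNReal.ofReal (2 ^ (-(n * levelDecay p q)) * (4 * averageConst p)) *
          ∫⁻ z, ENNReal.ofReal (|g z| ^ p) ∂K h + (Set.Iio (levelGap n)).indicator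
          (fun _ => ENNReal.ofReal (levelTruncation p n ^ q)) |(∫ z, g z ∂K h) - a h|) ∂ν := by
        refine lintegral_mono fun h =>
          (lintegral_abs_delta_succ_rpow_le hg hp hq hqp hs hε n (a h)).trans ?_
        gcongr ENNReal.ofReal ?_ * _ + _
        exact levelFactor_le hp hqp n
    _ ≤ _ := by
        rw [lintegral_add_left (hmoment.const_mul _), lintegral_const_mul _ hmoment, mul_add,
          ENNReal.ofReal_mul (by positivity), mul_assoc]
        gcongr

lemma abs_max_rpow_le (hq : 0 ≤ q) (hqp : q ≤ p) (x y : ℝ) :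
    |max x y| ^ q ≤ 1 + (|x| ^ p + |y| ^ p) := by
  have hmax : |max x y| ^ p ≤ |x| ^ p + |y| ^ p := by
    rcases max_choice x y with h | h <;> rw [h]
    · linarith [Real.rpow_nonneg (abs_nonneg y) p]
    · linarith [Real.rpow_nonneg (abs_nonneg x) p]
  have hle : |max x y| ^ q ≤ 1 + |max x y| ^ p := by
    rcases le_total |max x y| 1 with h | h
    · linarith [Real.rpow_le_one (abs_nonneg (max x y)) h hq,
        Real.rpow_nonneg (abs_nonneg (max x y)) p]
    · linarith [Real.rpow_le_rpow_of_exponent_le h hqp]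
  linarith

lemma lintegral_abs_delta_zero_rpow_lt_top [IsFiniteMeasure ν] (hg : Measurable g)
    (ha : Measurable a) (hq : 0 ≤ q) (hqp : q ≤ p)
    (hap : ∫⁻ h, ENNReal.ofReal (|a h| ^ p) ∂ν < ⊤)
    (hgp : ∫⁻ h, ∫⁻ z, ENNReal.ofReal (|g z| ^ p) ∂K h ∂ν < ⊤) :
    ∫⁻ h, ∫⁻ y : Fin (2 ^ 0) → α, ENNReal.ofReal (|delta 0 (a h) fun i => g (y i)| ^ q)
        ∂Measure.pi (fun _ => K h) ∂ν < ⊤ := by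
  have hm : Measurable fun z => ENNReal.ofReal (|g z| ^ p) := (hg.abs.pow_const p).ennreal_ofReal
  have hbound : ∀ h, ∫⁻ y : Fin (2 ^ 0) → α, ENNReal.ofReal (|delta 0 (a h) fun i => g (y i)| ^ q)
      ∂Measure.pi (fun _ => K h) ≤
      1 + (ENNReal.ofReal (|a h| ^ p) + ∫⁻ z, ENNReal.ofReal (|g z| ^ p) ∂K h) := fun h => by
    calc _ ≤ ∫⁻ y : Fin (2 ^ 0) → α, (1 + (ENNReal.ofReal (|a h| ^ p) +
          ENNReal.ofReal (|g (y 0)| ^ p))) ∂Measure.pi (fun _ => K h) := by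
          refine lintegral_mono fun y => (ENNReal.ofReal_le_ofReal
            (abs_max_rpow_le hq hqp (a h) (g (y 0)))).trans_eq ?_
          rw [ENNReal.ofReal_add zero_le_one (by positivity), ENNReal.ofReal_one,
            ENNReal.ofReal_add (by positivity) (by positivity)]
      _ = _ := by
          rw [lintegral_add_left measurable_const, lintegral_add_left measurable_const,
            (measurePreserving_eval (fun _ => K h) 0).lintegral_comp hm]
          simp
  refine (lintegral_mono hbound).trans_lt ?_
  rw [lintegral_add_left measurable_const,
    lintegral_add_left (ha.abs.pow_const p).ennreal_ofReal]
  simp [hap, hgp, measure_lt_top]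

end Level

/-! ### Values of the stopping problem and the law of the history -/

section Values

variable (π : (k : ℕ) → Kernel (Fin k → 𝒳) 𝒳)

/-- The Snell envelope: the value, at the history `h` of positive length `k + 1`, of stopping now or
at one of the `m` observations to come. -/
def snell (f : 𝒳 → ℝ) : (m k : ℕ) → (Fin (k + 1) → 𝒳) → ℝ
  | 0, k, h => f (h (Fin.last k))
  | m + 1, k, h => max (f (h (Fin.last k))) (∫ x, snell f m (k + 1) (extend (h, x)) ∂π (k + 1) h)

/-- The continuation value: the value, given the history `h` of length `k`, of stopping at one of
the next `m + 1` observations. -/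
def contValue (f : 𝒳 → ℝ) (m k : ℕ) (h : Fin k → 𝒳) : ℝ :=
  ∫ x, snell π f m k (extend (h, x)) ∂π k h

/-- The law of a history of length `k` that is sampled from the kernels `π`. -/
def historyLaw : (k : ℕ) → Measure (Fin k → 𝒳)
  | 0 => Measure.dirac Fin.elim0
  | k + 1 => (historyLaw k ⊗ₘ π k).map extend

variable {f : 𝒳 → ℝ}

lemma integral_fst_muse_zero (hf : Measurable f) (r : ℕ → unitInterval) (k : ℕ) (h : Fin k → 𝒳) :
    ∫ z, z.1 ∂muse π f r 0 k h = contValue π f 0 k h := by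
  rw [muse, Kernel.map_apply _ (by fun_prop),
    integral_map (by fun_prop) measurable_fst.aestronglyMeasurable]
  simp only [contValue, snell, extend_last]

variable [∀ k, IsMarkovKernel (π k)]

lemma measurable_snell (hf : Measurable f) (m k : ℕ) : Measurable (snell π f m k) := by
  induction m generalizing k with
  | zero => exact hf.comp (measurable_pi_apply _)
  | succ m ih =>
    exact (hf.comp (measurable_pi_apply _)).max (StronglyMeasurable.integral_kernel_prod_right
      (κ := π (k + 1)) (f := fun h x => snell π f m (k + 1) (extend (h, x)))
      ((ih (k + 1)).comp measurable_extend).stronglyMeasurable).measurable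

lemma measurable_contValue (hf : Measurable f) (m k : ℕ) : Measurable (contValue π f m k) :=
  (StronglyMeasurable.integral_kernel_prod_right (κ := π k)
    (f := fun h x => snell π f m k (extend (h, x)))
    ((measurable_snell π hf m k).comp measurable_extend).stronglyMeasurable).measurable

instance isProbabilityMeasure_historyLaw (k : ℕ) : IsProbabilityMeasure (historyLaw π k) := by
  induction k with
  | zero => rw [historyLaw]; infer_instance
  | succ k ih => exact Measure.isProbabilityMeasure_map measurable_extend.aemeasurable

lemma lintegral_historyLaw_succ (k : ℕ) {H : (Fin (k + 1) → 𝒳) → ENNReal} (hH : Measurable H) :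
    ∫⁻ h, H h ∂historyLaw π (k + 1) = ∫⁻ h, ∫⁻ x, H (extend (h, x)) ∂π k h ∂historyLaw π k := by
  rw [historyLaw, lintegral_map hH measurable_extend]
  exact Measure.lintegral_compProd (hH.comp measurable_extend)

lemma ae_ae_of_ae_historyLaw_succ {k : ℕ} {Q : (Fin (k + 1) → 𝒳) → Prop}
    (hQ : ∀ᵐ h ∂historyLaw π (k + 1), Q h) :
    ∀ᵐ h ∂historyLaw π k, ∀ᵐ x ∂π k h, Q (extend (h, x)) :=
  Measure.ae_ae_of_ae_compProd (ae_of_ae_map measurable_extend.aemeasurable hQ)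

variable {π}

lemma integrable_integral_extend {k : ℕ} {H : (Fin (k + 1) → 𝒳) → ℝ}
    (hH : Integrable H (historyLaw π (k + 1))) :
    Integrable (fun h => ∫ x, H (extend (h, x)) ∂π k h) (historyLaw π k) :=
  Integrable.integral_compProd (κ := Kernel.const Unit (historyLaw π k))
    (η := Kernel.prodMkLeft Unit (π k)) (a := ())
    (hH.comp_measurable (f := extend) measurable_extend)

lemma integrable_snell {T : ℕ}
    (hfi : ∀ k < T, Integrable (fun h => f (h (Fin.last k))) (historyLaw π (k + 1))) (m k : ℕ)
    (hk : k + m < T) : Integrable (snell π f m k) (historyLaw π (k + 1)) := by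
  induction m generalizing k with
  | zero => exact hfi k hk
  | succ m ih => exact (hfi k (by omega)).sup (integrable_integral_extend (ih (k + 1) (by omega)))

end Values

/-! ### One call of the estimator -/

section Geometric

variable {r : unitInterval} {ρ : ℝ}

lemma ne_zero_of_coe_eq_one_sub (hρ : 0 < ρ) (hr : (r : ℝ) = 1 - 2 ^ (-ρ)) : r ≠ 0 := by
  rintro rfl
  have := Real.rpow_lt_one_of_one_lt_of_neg one_lt_two (neg_neg_of_pos hρ)
  rw [Set.Icc.coe_zero] at hr
  linarith

lemma ne_one_of_coe_eq_one_sub (hr : (r : ℝ) = 1 - 2 ^ (-ρ)) : r ≠ 1 := by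
  rintro rfl
  have := Real.rpow_pos_of_pos two_pos (-ρ)
  rw [Set.Icc.coe_one] at hr
  linarith

lemma geoPMF_pos (hr0 : r ≠ 0) (hr1 : r ≠ 1) (n : ℕ) : 0 < geoPMF r n := by
  rw [geoPMF, mul_comm]
  exact geometricMeasure_pos hr0 hr1 n

lemma geoPMF_eq_mul_rpow (hr : (r : ℝ) = 1 - 2 ^ (-ρ)) (n : ℕ) :
    geoPMF r n = r * 2 ^ (-(n * ρ)) := by
  rw [geoPMF, hr, sub_sub_cancel, ← Real.rpow_natCast, ← Real.rpow_mul two_pos.le]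
  congr 2
  ring

lemma geoPMF_succ_rpow_mul_rpow (hr : (r : ℝ) = 1 - 2 ^ (-ρ)) (q decay : ℝ) (n : ℕ) :
    geoPMF r (n + 1) ^ (1 - q) * (2 : ℝ) ^ (-(n * decay)) =
      (r : ℝ) ^ (1 - q) * 2 ^ (ρ * (q - 1)) * ((2 : ℝ) ^ (ρ * (q - 1) - decay)) ^ n := by
  rw [geoPMF_eq_mul_rpow hr, Real.mul_rpow r.2.1 (by positivity), ← Real.rpow_mul two_pos.le,
    ← Real.rpow_natCast ((2 : ℝ) ^ _), ← Real.rpow_mul two_pos.le, mul_assoc, mul_assoc,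
    ← Real.rpow_add two_pos, ← Real.rpow_add two_pos]
  congr 2
  push_cast
  ring

lemma tsum_geoPMF_rpow_mul_lt_top (hρ : 0 < ρ) (hr : (r : ℝ) = 1 - 2 ^ (-ρ)) {q decay : ℝ}
    (hdecay : ρ * (q - 1) < decay) {D : ℕ → ENNReal} {B : ENNReal} (hD0 : D 0 < ⊤) (hB : B < ⊤)
    (hD : ∀ n : ℕ, D (n + 1) ≤ ENNReal.ofReal (2 ^ (-(n * decay))) * B) :
    ∑' n, ENNReal.ofReal (geoPMF r n ^ (1 - q)) * D n < ⊤ := by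
  have hpos := geoPMF_pos (ne_zero_of_coe_eq_one_sub hρ hr) (ne_one_of_coe_eq_one_sub hr)
  have hsum : Summable fun n : ℕ => geoPMF r (n + 1) ^ (1 - q) * (2 : ℝ) ^ (-(n * decay)) := by
    simp only [geoPMF_succ_rpow_mul_rpow hr]
    exact (summable_geometric_of_lt_one (by positivity)
      (Real.rpow_lt_one_of_one_lt_of_neg one_lt_two (by linarith))).mul_left _
  rw [tsum_eq_zero_add' ENNReal.summable]
  refine ENNReal.add_lt_top.2 ⟨ENNReal.mul_lt_top ENNReal.ofReal_lt_top hD0, ?_⟩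
  calc ∑' n, ENNReal.ofReal (geoPMF r (n + 1) ^ (1 - q)) * D (n + 1)
      ≤ ∑' n : ℕ, ENNReal.ofReal (geoPMF r (n + 1) ^ (1 - q) * (2 : ℝ) ^ (-(n * decay))) * B := by
        refine ENNReal.tsum_le_tsum fun n => ?_
        rw [ENNReal.ofReal_mul (Real.rpow_nonneg (hpos _).le _), mul_assoc]
        gcongr
        exact hD n
    _ < ⊤ := by
        rw [ENNReal.tsum_mul_right]
        exact ENNReal.mul_lt_top hsum.tsum_ofReal_lt_top hB

lemma ofReal_geoPMF_mul_lintegral_abs_combine_rpow (hr0 : r ≠ 0) (hr1 : r ≠ 1) (n : ℕ) (a q : ℝ)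
    (κ : Measure (Fin (2 ^ n) → ℝ × ℕ)) :
    ENNReal.ofReal (geoPMF r n) * ∫⁻ y, ENNReal.ofReal (|(combine r n a y).1| ^ q) ∂κ =
      ENNReal.ofReal (geoPMF r n ^ (1 - q)) *
        ∫⁻ y, ENNReal.ofReal (|delta n a fun i => (y i).1| ^ q) ∂κ := by
  have hpos := geoPMF_pos hr0 hr1 n
  have hcombine : ∀ y, ENNReal.ofReal (|(combine r n a y).1| ^ q) =
      ENNReal.ofReal (geoPMF r n ^ (-q)) * ENNReal.ofReal (|delta n a fun i => (y i).1| ^ q) :=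
    fun y => by
      rw [← ENNReal.ofReal_mul (Real.rpow_nonneg hpos.le _), combine, abs_div,
        Real.div_rpow (abs_nonneg _) (abs_nonneg _), abs_of_pos hpos, Real.rpow_neg hpos.le,
        div_eq_inv_mul]
  simp only [hcombine]
  rw [lintegral_const_mul' _ _ ENNReal.ofReal_ne_top, ← mul_assoc, ← ENNReal.ofReal_mul hpos.le,
    sub_eq_add_neg, Real.rpow_add hpos, Real.rpow_one]

end Geometric

section Call

variable (π : (k : ℕ) → Kernel (Fin k → 𝒳) 𝒳) [∀ k, IsMarkovKernel (π k)] {f : 𝒳 → ℝ}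

lemma lintegral_abs_muse_succ_rpow (hf : Measurable f) (r : ℕ → unitInterval) (m k : ℕ)
    (hr0 : r (k + 1) ≠ 0) (hr1 : r (k + 1) ≠ 1) (q : ℝ) :
    ∫⁻ h, ∫⁻ z, ENNReal.ofReal (|z.1| ^ q) ∂muse π f r (m + 1) k h ∂historyLaw π k =
      ∑' n, ENNReal.ofReal (geoPMF (r (k + 1)) n ^ (1 - q)) * ∫⁻ h,
        ∫⁻ y : Fin (2 ^ n) → ℝ × ℕ, ENNReal.ofReal
          (|delta n (f (h (Fin.last k))) fun i => (y i).1| ^ q)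
          ∂Measure.pi (fun _ => muse π f r m (k + 1) h) ∂historyLaw π (k + 1) := by
  have := isMarkovKernel_muse π hf r m (k + 1)
  have hlevel : ∀ n, Measurable fun h => ∫⁻ y : Fin (2 ^ n) → ℝ × ℕ,
      ENNReal.ofReal (|delta n (f (h (Fin.last k))) fun i => (y i).1| ^ q)
      ∂Measure.pi (fun _ => muse π f r m (k + 1) h) := fun n => by
    refine measurable_lintegral_pi _ (Measurable.ennreal_ofReal (Measurable.pow_const ?_ q))
    exact ((measurable_delta_comp (measurable_fst (α := ℝ) (β := ℕ)) n).comp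
      (Measurable.prodMk (by fun_prop) measurable_snd)).abs
  calc _ = ∫⁻ h, ∫⁻ x, ∑' n, ENNReal.ofReal (geoPMF (r (k + 1)) n ^ (1 - q)) *
        ∫⁻ y : Fin (2 ^ n) → ℝ × ℕ, ENNReal.ofReal
          (|delta n (f (extend (h, x) (Fin.last k))) fun i => (y i).1| ^ q)
          ∂Measure.pi (fun _ => muse π f r m (k + 1) (extend (h, x))) ∂π k h ∂historyLaw π k := by
        refine lintegral_congr fun h => ?_
        rw [lintegral_muse_succ π hf r m k hr0 h (F := fun z => ENNReal.ofReal (|z.1| ^ q))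
          (by fun_prop)]
        simp only [ofReal_geoPMF_mul_lintegral_abs_combine_rpow hr0 hr1, extend_last]
    _ = _ := by
        rw [← lintegral_historyLaw_succ π k (H := fun h => ∑' n, ENNReal.ofReal
          (geoPMF (r (k + 1)) n ^ (1 - q)) * ∫⁻ y : Fin (2 ^ n) → ℝ × ℕ, ENNReal.ofReal
          (|delta n (f (h (Fin.last k))) fun i => (y i).1| ^ q)
          ∂Measure.pi (fun _ => muse π f r m (k + 1) h))
          (Measurable.tsum fun n => (hlevel n).const_mul _),
          lintegral_tsum fun n => ((hlevel n).const_mul _).aemeasurable]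
        exact tsum_congr fun n => lintegral_const_mul _ (hlevel n)

lemma lintegral_abs_muse_succ_rpow_lt_top (hf : Measurable f) {r : ℕ → unitInterval} {m k : ℕ}
    {ρ p q C : ℝ} (hρ : 0 < ρ) (hr : (r (k + 1) : ℝ) = 1 - 2 ^ (-ρ)) (hp : 2 ≤ p) (hq : 0 < q)
    (hqp : q ≤ p) (hdecay : ρ * (q - 1) < levelDecay p q)
    (hrec : ∫⁻ h, ∫⁻ z, ENNReal.ofReal (|z.1| ^ p) ∂muse π f r m (k + 1) h
      ∂historyLaw π (k + 1) < ⊤)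
    (hfp : ∫⁻ h, ENNReal.ofReal (|f (h (Fin.last k))| ^ p) ∂historyLaw π (k + 1) < ⊤)
    (hC : ∀ ε > 0, historyLaw π (k + 1) {h | |(∫ z, z.1 ∂muse π f r m (k + 1) h) -
      f (h (Fin.last k))| < ε} ≤ ENNReal.ofReal (C * ε)) :
    ∫⁻ h, ∫⁻ z, ENNReal.ofReal (|z.1| ^ q) ∂muse π f r (m + 1) k h ∂historyLaw π k < ⊤ := by
  have := isMarkovKernel_muse π hf r m (k + 1)
  have ha : Measurable fun h : Fin (k + 1) → 𝒳 => f (h (Fin.last k)) :=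
    hf.comp (measurable_pi_apply _)
  rw [lintegral_abs_muse_succ_rpow π hf r m k (ne_zero_of_coe_eq_one_sub hρ hr)
    (ne_one_of_coe_eq_one_sub hr)]
  exact tsum_geoPMF_rpow_mul_lt_top hρ hr hdecay
    (lintegral_abs_delta_zero_rpow_lt_top measurable_fst ha hq.le hqp hfp hrec)
    (ENNReal.add_lt_top.2 ⟨ENNReal.mul_lt_top ENNReal.ofReal_lt_top hrec, ENNReal.ofReal_lt_top⟩)
    (lintegral_abs_delta_succ_rpow_le_of_regular measurable_fst ha hp hq hqp hC)

lemma extendLaw_apply (k : ℕ) (h : Fin k → 𝒳) :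
    (Kernel.id ×ₖ π k).map extend h = (π k h).map fun x => extend (h, x) := by
  rw [Kernel.map_apply _ measurable_extend, Kernel.prod_apply, Kernel.id_apply,
    Measure.dirac_prod, Measure.map_map measurable_extend measurable_prodMk_left]
  rfl

lemma geoPMF_mul_integral_fst_branch (hf : Measurable f) {r : unitInterval} (hr0 : r ≠ 0)
    (hr1 : r ≠ 1) {k : ℕ} (K : Kernel (Fin (k + 1) → 𝒳) (ℝ × ℕ)) [IsMarkovKernel K]
    (h : Fin (k + 1) → 𝒳) (n : ℕ) :
    geoPMF r n * ∫ z, z.1 ∂branch f r K (h, n) =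
      ∫ y : Fin (2 ^ n) → ℝ × ℕ, delta n (f (h (Fin.last k))) (fun i => (y i).1)
        ∂Measure.pi fun _ => K h := by
  have hc := measurable_combine_last hf r n k
  have hbranch : ∫ z, z.1 ∂branch f r K (h, n) = (∫ y : Fin (2 ^ n) → ℝ × ℕ,
      delta n (f (h (Fin.last k))) (fun i => (y i).1) ∂Measure.pi fun _ => K h) / geoPMF r n := by
    rw [branch_apply, Kernel.map_apply _ hc,
      integral_map hc.aemeasurable measurable_fst.aestronglyMeasurable, Kernel.prod_apply,
      Kernel.id_apply, Measure.dirac_prod, iid_apply, ← integral_div]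
    exact integral_map measurable_prodMk_left.aemeasurable
      (measurable_fst.comp hc).aestronglyMeasurable
  rw [hbranch, mul_div_cancel₀ _ (geoPMF_pos hr0 hr1 n).ne']

lemma integral_branch_geometric (hf : Measurable f) {r : unitInterval} (hr0 : r ≠ 0)
    (hr1 : r ≠ 1) {k : ℕ} (K : Kernel (Fin (k + 1) → 𝒳) (ℝ × ℕ)) [IsMarkovKernel K]
    (h : Fin (k + 1) → 𝒳) (hK : MemLp (fun z : ℝ × ℕ => z.1) 2 (K h))
    (hi : Integrable (fun n => ∫ z, z.1 ∂branch f r K (h, n)) (geometricMeasure r)) :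
    ∫ n, ∫ z, z.1 ∂branch f r K (h, n) ∂geometricMeasure r =
      max (f (h (Fin.last k))) (∫ z, z.1 ∂K h) := by
  have hsum := hasSum_integral_geometricMeasure hr0 hi
  have hterm : ∀ n, ((1 - r : ℝ) ^ n * r) • ∫ z, z.1 ∂branch f r K (h, n) =
      ∫ y : Fin (2 ^ n) → ℝ × ℕ, delta n (f (h (Fin.last k))) (fun i => (y i).1)
        ∂Measure.pi fun _ => K h := fun n => by
    rw [← geoPMF_mul_integral_fst_branch hf hr0 hr1, geoPMF, smul_eq_mul, mul_comm (r : ℝ)]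
  simp only [hterm] at hsum
  exact hsum.unique (hasSum_integral_delta measurable_fst hK _ hsum.summable)

lemma integral_fst_muse_succ (hf : Measurable f) {r : ℕ → unitInterval} {m k : ℕ}
    (hr0 : r (k + 1) ≠ 0) (hr1 : r (k + 1) ≠ 1) {h : Fin k → 𝒳}
    (hi : Integrable (fun z : ℝ × ℕ => z.1) (muse π f r (m + 1) k h))
    (hrec : ∀ᵐ x ∂π k h, MemLp (fun z : ℝ × ℕ => z.1) 2 (muse π f r m (k + 1) (extend (h, x))) ∧
      ∫ z, z.1 ∂muse π f r m (k + 1) (extend (h, x)) = contValue π f m (k + 1) (extend (h, x))) :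
    ∫ z, z.1 ∂muse π f r (m + 1) k h = contValue π f (m + 1) k h := by
  have := isMarkovKernel_muse π hf r m (k + 1)
  have := isMarkovKernel_branch hf (r (k + 1)) (muse π f r m (k + 1))
  have := Kernel.IsMarkovKernel.map (Kernel.id ×ₖ π k) (measurable_extend (𝒳 := 𝒳) (k := k))
  have hem : Measurable fun x => extend (h, x) := measurable_extend.comp measurable_prodMk_left
  rw [muse] at hi ⊢
  have hcomp := hi.integral_comp
  rw [Kernel.integral_comp hi]
  rw [Kernel.prod_apply, Kernel.const_apply, extendLaw_apply] at hcomp ⊢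
  rw [integral_prod _ hcomp, contValue,
    integral_map hem.aemeasurable hcomp.integral_prod_left.aestronglyMeasurable]
  refine integral_congr_ae ?_
  filter_upwards [ae_of_ae_map hem.aemeasurable hcomp.prod_right_ae, hrec] with x hx hmean
  rw [integral_branch_geometric hf hr0 hr1 _ _ hmean.1 hx, hmean.2]
  rfl

end Call

/-! ### Moments and mean of the estimator -/

section Exponent

variable {T : ℕ} {η : ℝ} {k : ℕ}

/-- The order of a moment of the output that stays finite when `k` observations have been sampled;
each stage of the recursion loses nine tenths of the excess over `2`. -/
def momentExponent (T : ℕ) (η : ℝ) (k : ℕ) : ℝ := 2 + η * (10 : ℝ) ^ ((k : ℤ) + 1 - T)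

lemma two_lt_momentExponent (hη : 0 < η) : 2 < momentExponent T η k :=
  lt_add_of_pos_right 2 (by positivity)

lemma momentExponent_le (hη : 0 < η) (hk : k < T) : momentExponent T η k ≤ 2 + η := by
  refine add_le_add_right (mul_le_of_le_one_right hη.le ?_) 2
  exact zpow_le_one_of_nonpos₀ (by norm_num) (by omega)

lemma momentExponent_succ_sub_two (T : ℕ) (η : ℝ) (k : ℕ) :
    momentExponent T η (k + 1) - 2 = 10 * (momentExponent T η k - 2) := by
  simp only [momentExponent, add_sub_cancel_left]
  rw [show ((k + 1 : ℕ) : ℤ) + 1 - T = ((k : ℤ) + 1 - T) + 1 by push_cast; ring,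
    zpow_add_one₀ (by norm_num)]
  ring

lemma momentExponent_le_succ (hη : 0 < η) : momentExponent T η k ≤ momentExponent T η (k + 1) := by
  linarith [momentExponent_succ_sub_two T η k, two_lt_momentExponent (T := T) (k := k) hη]

lemma rate_eq_div (T : ℕ) (η : ℝ) (k : ℕ) : rate T η (k + 1) =
    (2 + 9 * (momentExponent T η k - 2) / (4 * momentExponent T η (k + 1))) /
      momentExponent T η k := by
  have hsucc := momentExponent_succ_sub_two T η k
  rw [rate, show 2 + η * (10 : ℝ) ^ (((k + 1 : ℕ) : ℤ) - T) = momentExponent T η k by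
      rw [momentExponent]; push_cast; ring_nf,
    show η * (10 : ℝ) ^ (((k + 1 : ℕ) : ℤ) + 1 - T) = momentExponent T η (k + 1) - 2 by
      rw [momentExponent]; ring,
    show 80 + 40 * (momentExponent T η (k + 1) - 2) = 10 * (4 * momentExponent T η (k + 1)) by ring,
    hsucc, mul_left_comm, mul_div_mul_left _ _ (by norm_num)]

lemma one_lt_rate (hη : 0 < η) (hη4 : η < 1 / 4) (hk : k + 1 < T) : 1 < rate T η (k + 1) := by
  have hlt := two_lt_momentExponent (T := T) (k := k) hη
  have hle := momentExponent_le hη hk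
  rw [rate_eq_div, one_lt_div (by linarith), ← sub_lt_iff_lt_add',
    lt_div_iff₀ (by linarith [momentExponent_le_succ (T := T) (k := k) hη])]
  nlinarith

lemma rate_mul_lt_levelDecay (hη : 0 < η) (hη4 : η < 1 / 4) (hk : k + 1 < T) :
    rate T η (k + 1) * (momentExponent T η k - 1) <
      levelDecay (momentExponent T η (k + 1)) (momentExponent T η k) := by
  have hlt := two_lt_momentExponent (T := T) (k := k) hη
  have hrate : rate T η (k + 1) * momentExponent T η k = 2 +
      9 * (momentExponent T η k - 2) / (4 * momentExponent T η (k + 1)) := by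
    rw [rate_eq_div, div_mul_cancel₀ _ (by linarith)]
  have hgain : momentExponent T η (k + 1) - momentExponent T η k =
      9 * (momentExponent T η k - 2) := by linarith [momentExponent_succ_sub_two T η k]
  rw [mul_sub_one, hrate, levelDecay, hgain]
  linarith [one_lt_rate hη hη4 hk]

end Exponent

section Estimator

variable (π : (k : ℕ) → Kernel (Fin k → 𝒳) 𝒳) [∀ k, IsMarkovKernel (π k)] {f : 𝒳 → ℝ}

lemma ae_memLp_muse (hf : Measurable f) {r : ℕ → unitInterval} {m k : ℕ} {p : ℝ} (hp : 2 ≤ p)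
    (h : ∫⁻ h, ∫⁻ z, ENNReal.ofReal (|z.1| ^ p) ∂muse π f r m k h ∂historyLaw π k < ⊤) :
    ∀ᵐ h ∂historyLaw π k, MemLp (fun z : ℝ × ℕ => z.1) 2 (muse π f r m k h) := by
  have := isMarkovKernel_muse π hf r m k
  have hmeas : Measurable fun h => ∫⁻ z, ENNReal.ofReal (|z.1| ^ p) ∂muse π f r m k h :=
    Measurable.lintegral_kernel (f := fun z : ℝ × ℕ => ENNReal.ofReal (|z.1| ^ p)) (by fun_prop)
  filter_upwards [ae_lt_top hmeas h.ne] with h hh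
  refine (memLp_of_lintegral_abs_rpow_lt_top (by linarith)
    measurable_fst.aestronglyMeasurable hh).mono_exponent ?_
  rw [← ENNReal.ofReal_ofNat]
  exact ENNReal.ofReal_le_ofReal hp

lemma lintegral_abs_rpow_lt_top_of_le {α : Type*} [MeasurableSpace α] {μ : Measure α}
    [IsFiniteMeasure μ] {g : α → ℝ} {p q : ℝ} (hq : 0 ≤ q) (hqp : q ≤ p)
    (h : ∫⁻ x, ENNReal.ofReal (|g x| ^ p) ∂μ < ⊤) : ∫⁻ x, ENNReal.ofReal (|g x| ^ q) ∂μ < ⊤ := by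
  have hle : ∀ y : ℝ, |y| ^ q ≤ 1 + |y| ^ p := fun y => by
    rcases le_total |y| 1 with hy | hy
    · linarith [Real.rpow_le_one (abs_nonneg y) hy hq, Real.rpow_nonneg (abs_nonneg y) p]
    · linarith [Real.rpow_le_rpow_of_exponent_le hy hqp]
  calc ∫⁻ x, ENNReal.ofReal (|g x| ^ q) ∂μ
      ≤ ∫⁻ x, 1 + ENNReal.ofReal (|g x| ^ p) ∂μ := lintegral_mono fun x => by
        rw [← ENNReal.ofReal_one, ← ENNReal.ofReal_add zero_le_one (by positivity)]
        exact ENNReal.ofReal_le_ofReal (hle _)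
    _ < ⊤ := by
        rw [lintegral_add_left measurable_const, lintegral_const]
        finiteness

theorem muse_moment_and_mean (hf : Measurable f) {T : ℕ} {η : ℝ} (hη : 0 < η) (hη4 : η < 1 / 4)
    (hfη : ∀ k < T, ∫⁻ h, ENNReal.ofReal (|f (h (Fin.last k))| ^ (2 + η)) ∂historyLaw π (k + 1) < ⊤)
    {C : ℝ}
    (hC : ∀ m k, k + 1 + m + 1 = T → ∀ ε > 0, historyLaw π (k + 1)
      {h | |contValue π f m (k + 1) h - f (h (Fin.last k))| < ε} ≤ ENNReal.ofReal (C * ε))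
    (m k : ℕ) (hk : k + m + 1 = T) :
    ∫⁻ h, ∫⁻ z, ENNReal.ofReal (|z.1| ^ momentExponent T η k)
        ∂muse π f (museParam T η hη) m k h ∂historyLaw π k < ⊤ ∧
      ∀ᵐ h ∂historyLaw π k, ∫ z, z.1 ∂muse π f (museParam T η hη) m k h = contValue π f m k h := by
  have hf_lower : ∀ j {i : ℕ}, j < T → i < T → ∫⁻ h, ENNReal.ofReal
      (|f (h (Fin.last j))| ^ momentExponent T η i) ∂historyLaw π (j + 1) < ⊤ := fun j i hj hi =>
    lintegral_abs_rpow_lt_top_of_le (by linarith [two_lt_momentExponent (T := T) (k := i) hη])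
      (momentExponent_le hη hi) (hfη j hj)
  induction m generalizing k with
  | zero =>
    refine ⟨?_, ae_of_all _ (integral_fst_muse_zero π hf _ k)⟩
    have hlast := hf_lower k (i := k) (by omega) (by omega)
    rw [lintegral_historyLaw_succ π k (by fun_prop)] at hlast
    simp only [extend_last] at hlast
    simpa only [lintegral_muse_zero π hf (museParam T η hη) k _
      (F := fun z => ENNReal.ofReal (|z.1| ^ momentExponent T η k)) (by fun_prop)] using hlast
  | succ m ih =>
    obtain ⟨hmoment, hmean⟩ := ih (k + 1) (by omega)
    have hkT : k + 1 < T := by omega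
    have hp2 := two_lt_momentExponent (T := T) (k := k) hη
    have hρ := one_pos.trans (one_lt_rate hη hη4 hkT)
    have hr : (museParam T η hη (k + 1) : ℝ) = 1 - 2 ^ (-rate T η (k + 1)) := rfl
    have hregular : ∀ ε > 0, historyLaw π (k + 1) {h | |(∫ z, z.1 ∂muse π f (museParam T η hη) m
        (k + 1) h) - f (h (Fin.last k))| < ε} ≤ ENNReal.ofReal (C * ε) := fun ε hε =>
      (measure_mono_ae (hmean.mono fun h hh hlt =>
        show |contValue π f m (k + 1) h - f (h (Fin.last k))| < ε from hh ▸ hlt)).trans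
        (hC m k (by omega) ε hε)
    have hmoment' := lintegral_abs_muse_succ_rpow_lt_top π hf hρ hr
      (two_lt_momentExponent hη).le (by linarith) (momentExponent_le_succ hη)
      (rate_mul_lt_levelDecay hη hη4 hkT) hmoment (hf_lower k (by omega) hkT) hregular
    refine ⟨hmoment', ?_⟩
    filter_upwards [ae_memLp_muse π hf hp2.le hmoment', ae_ae_of_ae_historyLaw_succ π
      ((ae_memLp_muse π hf (two_lt_momentExponent hη).le hmoment).and hmean)] with h hmem hrec
    have := isMarkovKernel_muse π hf (museParam T η hη) (m + 1) k
    exact integral_fst_muse_succ π hf (ne_zero_of_coe_eq_one_sub hρ hr)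
      (ne_one_of_coe_eq_one_sub hr) (hmem.integrable one_le_two) hrec

/-! ### The cost -/

lemma three_add_arithCost_le (n : ℕ) : 3 + arithCost n ≤ 2 ^ n * 11 := by
  cases n with
  | zero => simp [arithCost]
  | succ n =>
    have := Nat.lt_two_pow_self (n := n)
    simp only [arithCost, pow_succ]
    omega

lemma lintegral_pi_eval {β : Type*} [MeasurableSpace β] (μ : Measure β) [IsProbabilityMeasure μ]
    {n : ℕ} (i : Fin n) {F : β → ENNReal} (hF : Measurable F) :
    ∫⁻ y : Fin n → β, F (y i) ∂Measure.pi (fun _ => μ) = ∫⁻ z, F z ∂μ :=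
  (measurePreserving_eval (fun _ : Fin n => μ) i).lintegral_comp hF

lemma lintegral_pi_sum_cost (μ : Measure (ℝ × ℕ)) [IsProbabilityMeasure μ] (n : ℕ)
    (c : ENNReal) :
    ∫⁻ y : Fin n → ℝ × ℕ, ∑ i, ((y i).2 : ENNReal) + c ∂Measure.pi (fun _ => μ) =
      n * ∫⁻ z, (z.2 : ENNReal) ∂μ + c := by
  rw [lintegral_add_right _ measurable_const, lintegral_finsetSum _ (by fun_prop),
    lintegral_const, measure_univ, mul_one]
  simp only [lintegral_pi_eval μ _ (F := fun z => (z.2 : ENNReal)) (by fun_prop),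
    Finset.sum_const, Finset.card_univ, Fintype.card_fin, nsmul_eq_mul]

lemma lintegral_combine_cost_le (μ : Measure (ℝ × ℕ)) [IsProbabilityMeasure μ] (r : unitInterval)
    (n : ℕ) (a : ℝ) :
    ∫⁻ y, ((combine r n a y).2 : ENNReal) ∂Measure.pi (fun _ => μ) ≤
      2 ^ n * (∫⁻ z, (z.2 : ENNReal) ∂μ + 11) := by
  have hle : ∀ y : Fin (2 ^ n) → ℝ × ℕ,
      ((combine r n a y).2 : ENNReal) ≤ ∑ i, ((y i).2 : ENNReal) + 2 ^ n * 11 := fun y => by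
    have : (combine r n a y).2 ≤ (∑ i, (y i).2) + 2 ^ n * 11 := by
      have := three_add_arithCost_le n
      simp only [combine]
      omega
    exact_mod_cast this
  refine (lintegral_mono hle).trans_eq ?_
  rw [lintegral_pi_sum_cost, mul_add]
  push_cast
  rfl

lemma tsum_geoPMF_mul_two_pow_lt_top {r : unitInterval} (hr : 1 / 2 < (r : ℝ)) :
    ∑' n, ENNReal.ofReal (geoPMF r n) * 2 ^ n < ⊤ := by
  have hr1 : (r : ℝ) ≤ 1 := r.2.2
  have hterm : ∀ n, ENNReal.ofReal (geoPMF r n) * 2 ^ n =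
      ENNReal.ofReal (r * ((1 - r) * 2) ^ n) := fun n => by
    rw [← ENNReal.ofReal_ofNat, ← ENNReal.ofReal_pow two_pos.le,
      ← ENNReal.ofReal_mul' (by positivity), geoPMF, mul_assoc, mul_pow]
  simp only [hterm]
  exact ((summable_geometric_of_lt_one (by linarith) (by linarith)).mul_left _).tsum_ofReal_lt_top

lemma half_lt_museParam {T : ℕ} {η : ℝ} (hη : 0 < η) (hη4 : η < 1 / 4) {k : ℕ} (hk : k + 1 < T) :
    1 / 2 < (museParam T η hη (k + 1) : ℝ) := by
  have hlt : (2 : ℝ) ^ (-rate T η (k + 1)) < 2 ^ (-1 : ℝ) :=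
    Real.rpow_lt_rpow_of_exponent_lt one_lt_two (neg_lt_neg (one_lt_rate hη hη4 hk))
  rw [Real.rpow_neg_one] at hlt
  change 1 / 2 < 1 - (2 : ℝ) ^ (-rate T η (k + 1))
  linarith

lemma exists_lintegral_cost_muse_le (hf : Measurable f) {r : ℕ → unitInterval} {m k : ℕ}
    (hr : ∀ i, k < i → i ≤ k + m → 1 / 2 < (r i : ℝ)) :
    ∃ c < ⊤, ∀ h, ∫⁻ z, (z.2 : ENNReal) ∂muse π f r m k h ≤ c := by
  induction m generalizing k with
  | zero =>
    refine ⟨2, by finiteness, fun h => ?_⟩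
    rw [lintegral_muse_zero π hf _ _ _ (by fun_prop)]
    simp
  | succ m ih =>
    obtain ⟨c, hc, hle⟩ := ih (k := k + 1) fun i hi hi' => hr i (by omega) (by omega)
    have := isMarkovKernel_muse π hf r m (k + 1)
    have hrk := hr (k + 1) (by omega) (by omega)
    have hr0 : r (k + 1) ≠ 0 := fun h0 => by norm_num [h0] at hrk
    refine ⟨(∑' n, ENNReal.ofReal (geoPMF (r (k + 1)) n) * 2 ^ n) * (c + 11),
      ENNReal.mul_lt_top (tsum_geoPMF_mul_two_pow_lt_top hrk) (by finiteness), fun h => ?_⟩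
    rw [lintegral_muse_succ π hf r m k hr0 h (by fun_prop), ← ENNReal.tsum_mul_right]
    refine lintegral_le_const (ae_of_all _ fun x => ENNReal.tsum_le_tsum fun n => ?_)
    rw [mul_assoc]
    gcongr
    exact (lintegral_combine_cost_le _ _ n _).trans (by gcongr; exact hle _)

end Estimator

/-! ### Averages -/

section Average

lemma measurable_average (n : ℕ) : Measurable fun y : Fin n → ℝ × ℕ =>
    (((∑ i, (y i).1) / n, (∑ i, (y i).2) + n) : ℝ × ℕ) := by fun_prop

variable {μ : Measure (ℝ × ℕ)} [IsProbabilityMeasure μ]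

instance isProbabilityMeasure_averageLaw (n : ℕ) : IsProbabilityMeasure (averageLaw μ n) :=
  Measure.isProbabilityMeasure_map (measurable_average n).aemeasurable

lemma memLp_pi_eval {p : ENNReal} (hμ : MemLp (fun z : ℝ × ℕ => z.1) p μ) {n : ℕ} (i : Fin n) :
    MemLp (fun y : Fin n → ℝ × ℕ => (y i).1) p (Measure.pi fun _ => μ) :=
  hμ.comp_measurePreserving (measurePreserving_eval (fun _ => μ) i)

lemma integral_average (hμ : Integrable (fun z : ℝ × ℕ => z.1) μ) {n : ℕ} (hn : n ≠ 0) :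
    ∫ y : Fin n → ℝ × ℕ, (∑ i, (y i).1) / n ∂Measure.pi (fun _ => μ) = ∫ z, z.1 ∂μ := by
  have heval : ∀ i : Fin n, ∫ y : Fin n → ℝ × ℕ, (y i).1 ∂Measure.pi (fun _ => μ) =
      ∫ z, z.1 ∂μ := fun i =>
    integral_comp_eval (μ := fun _ : Fin n => μ) measurable_fst.aestronglyMeasurable
  rw [integral_div, integral_finsetSum _ fun i _ => memLp_one_iff_integrable.1
    (memLp_pi_eval (memLp_one_iff_integrable.2 hμ) i)]
  simp only [heval, Finset.sum_const, Finset.card_univ, Fintype.card_fin, nsmul_eq_mul]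
  exact mul_div_cancel_left₀ _ (Nat.cast_ne_zero.2 hn)

lemma variance_average (hμ : MemLp (fun z : ℝ × ℕ => z.1) 2 μ) {n : ℕ} (hn : n ≠ 0) :
    variance (fun y : Fin n → ℝ × ℕ => (∑ i, (y i).1) / n) (Measure.pi fun _ => μ) =
      variance (fun z : ℝ × ℕ => z.1) μ / n := by
  have hsum : variance (fun y : Fin n → ℝ × ℕ => ∑ i, (y i).1) (Measure.pi fun _ => μ) =
      n * variance (fun z : ℝ × ℕ => z.1) μ := by
    have := variance_sum_pi (μ := fun _ : Fin n => μ) (X := fun _ z => z.1) fun _ => hμ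
    simpa [Finset.sum_fn] using this
  simp only [div_eq_inv_mul, variance_const_mul, hsum]
  field_simp

lemma lintegral_averageLaw_sq (hμ : MemLp (fun z : ℝ × ℕ => z.1) 2 μ) {n : ℕ} (hn : n ≠ 0) :
    ∫⁻ z, ENNReal.ofReal ((z.1 - ∫ w, w.1 ∂μ) ^ 2) ∂averageLaw μ n =
      ENNReal.ofReal (variance (fun z : ℝ × ℕ => z.1) μ / n) := by
  have hmem : MemLp (fun y : Fin n → ℝ × ℕ => (∑ i, (y i).1) / n) 2 (Measure.pi fun _ => μ) := by
    simpa only [div_eq_inv_mul] using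
      (memLp_finsetSum _ fun i _ => memLp_pi_eval hμ i).const_mul _
  rw [averageLaw, lintegral_map (by fun_prop) (measurable_average n), ← variance_average hμ hn,
    hmem.ofReal_variance_eq, evariance_eq_lintegral_ofReal,
    integral_average (hμ.integrable one_le_two) hn]

lemma lintegral_averageLaw_cost (n : ℕ) :
    ∫⁻ z, (z.2 : ENNReal) ∂averageLaw μ n = n * (∫⁻ z, (z.2 : ENNReal) ∂μ + 1) := by
  rw [averageLaw, lintegral_map (by fun_prop) (measurable_average n), mul_add, mul_one,
    ← lintegral_pi_sum_cost]
  push_cast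
  rfl

lemma sampleSize_pos (V ε : ℝ) : 0 < sampleSize V ε := lt_of_lt_of_le one_pos (le_max_left _ _)

lemma div_sampleSize_le (V : ℝ) {ε : ℝ} (hε : 0 < ε) : V / sampleSize V ε ≤ ε ^ 2 := by
  have hceil : V / ε ^ 2 ≤ sampleSize V ε :=
    (Nat.le_ceil _).trans (Nat.cast_le.2 (le_max_right _ _))
  exact div_le_of_le_mul₀ (Nat.cast_nonneg _) (by positivity)
    ((div_le_iff₀' (by positivity)).1 hceil)

lemma sampleSize_le {V : ℝ} (hV : 0 ≤ V) (ε : ℝ) :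
    (sampleSize V ε : ℝ) ≤ (V + 1) * max 1 (1 / ε ^ 2) := by
  have hmax : V * (1 / ε ^ 2) ≤ V * max 1 (1 / ε ^ 2) := by gcongr; exact le_max_right _ _
  have hone : (1 : ℝ) ≤ max 1 (1 / ε ^ 2) := le_max_left _ _
  have hceil := (Nat.ceil_lt_add_one (by positivity : 0 ≤ V / ε ^ 2)).le
  rw [div_eq_mul_one_div] at hceil
  rw [sampleSize, Nat.cast_max, Nat.cast_one, div_eq_mul_one_div]
  refine max_le ?_ ?_
  · nlinarith
  · linarith

lemma exists_averageLaw_error_and_cost_le (hμ : MemLp (fun z : ℝ × ℕ => z.1) 2 μ)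
    (hcost : ∫⁻ z, (z.2 : ENNReal) ∂μ < ⊤) :
    ∃ K : ℝ, ∀ ε > 0,
      ∫⁻ z, ENNReal.ofReal ((z.1 - ∫ w, w.1 ∂μ) ^ 2)
        ∂averageLaw μ (sampleSize (variance (fun z => z.1) μ) ε) ≤ ENNReal.ofReal (ε ^ 2) ∧
      ∫⁻ z, (z.2 : ENNReal) ∂averageLaw μ (sampleSize (variance (fun z => z.1) μ) ε) ≤
        ENNReal.ofReal (K * max 1 (1 / ε ^ 2)) := by
  set V := variance (fun z : ℝ × ℕ => z.1) μ
  set c := ∫⁻ z, (z.2 : ENNReal) ∂μ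
  have hV : 0 ≤ V := variance_nonneg _ _
  refine ⟨(V + 1) * (c.toReal + 1), fun ε hε => ⟨?_, ?_⟩⟩
  · rw [lintegral_averageLaw_sq hμ (sampleSize_pos V ε).ne']
    exact ENNReal.ofReal_le_ofReal (div_sampleSize_le V hε)
  · calc ∫⁻ z, (z.2 : ENNReal) ∂averageLaw μ (sampleSize V ε)
        = ENNReal.ofReal (sampleSize V ε * (c.toReal + 1)) := by
          rw [lintegral_averageLaw_cost, ENNReal.ofReal_mul (Nat.cast_nonneg _),
            ENNReal.ofReal_natCast, ENNReal.ofReal_add ENNReal.toReal_nonneg zero_le_one,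
            ENNReal.ofReal_toReal hcost.ne, ENNReal.ofReal_one]
      _ ≤ ENNReal.ofReal ((V + 1) * max 1 (1 / ε ^ 2) * (c.toReal + 1)) := by
          gcongr
          exact sampleSize_le hV ε
      _ = _ := by ring_nf

end Average

/-! ### Optional stopping with finitely many times -/

section OptionalStopping

variable {Ω : Type*} {mΩ : MeasurableSpace Ω} {P : Measure Ω} {n : ℕ} {V : Fin (n + 1) → Ω → ℝ}
  {τ : Ω → Fin (n + 1)}

lemma measurable_of_isStoppingTime {ℱ : Filtration (Fin (n + 1)) mΩ}
    (hτ : IsStoppingTime ℱ fun ω => (τ ω : WithTop (Fin (n + 1)))) : Measurable τ :=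
  measurable_of_Iic fun i => by
    have hle := ℱ.le i _ (hτ.measurableSet_le i)
    simp only [WithTop.coe_le_coe] at hle
    exact hle

lemma integrable_stopped (hV : ∀ i, Integrable (V i) P) (hτ : Measurable τ) :
    Integrable (fun ω => V (τ ω) ω) P := by
  have hsum : (fun ω => V (τ ω) ω) = fun ω => ∑ i, (τ ⁻¹' {i}).indicator (V i) ω := by
    ext ω
    have hother : ∀ i ≠ τ ω, (τ ⁻¹' {i}).indicator (V i) ω = 0 := fun i hi =>
      Set.indicator_of_notMem (s := τ ⁻¹' {i}) hi.symm _
    rw [Fintype.sum_eq_single _ hother]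
    exact (Set.indicator_of_mem (s := τ ⁻¹' {τ ω}) rfl _).symm
  rw [hsum]
  exact integrable_finsetSum _ fun i _ => (hV i).indicator (hτ (measurableSet_singleton i))

lemma integral_stopped_le_integral_zero (hV : ∀ i, Integrable (V i) P) (hτ : Measurable τ)
    (hstep : ∀ i : Fin n, ∫ ω in {ω | i.castSucc < τ ω}, V i.succ ω ∂P ≤
      ∫ ω in {ω | i.castSucc < τ ω}, V i.castSucc ω ∂P) :
    ∫ ω, V (τ ω) ω ∂P ≤ ∫ ω, V 0 ω ∂P := by
  have hVτ := integrable_stopped hV hτ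
  have hmeas : ∀ s : Set (Fin (n + 1)), MeasurableSet {ω | τ ω ∈ s} := fun s =>
    hτ (MeasurableSet.of_discrete (s := s))
  suffices hfrom : ∀ i, ∫ ω in {ω | i ≤ τ ω}, V (τ ω) ω ∂P ≤ ∫ ω in {ω | i ≤ τ ω}, V i ω ∂P by
    simpa using hfrom 0
  intro i
  induction i using Fin.reverseInduction with
  | last =>
    exact (setIntegral_congr_fun (hmeas (Set.Ici _)) fun ω hω => by
      rw [le_antisymm (Fin.le_last _) hω]).le
  | cast i ih =>
    have hunion : {ω | i.castSucc ≤ τ ω} = {ω | τ ω = i.castSucc} ∪ {ω | i.castSucc < τ ω} := by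
      ext ω
      exact (le_iff_eq_or_lt (a := i.castSucc) (b := τ ω)).trans (or_congr_left eq_comm)
    have hdisj : Disjoint {ω | τ ω = i.castSucc} {ω | i.castSucc < τ ω} :=
      Set.disjoint_left.2 fun ω (heq : τ ω = _) hlt => hlt.ne' heq
    have hsplit : ∀ {W : Ω → ℝ}, Integrable W P → ∫ ω in {ω | i.castSucc ≤ τ ω}, W ω ∂P =
        ∫ ω in {ω | τ ω = i.castSucc}, W ω ∂P + ∫ ω in {ω | i.castSucc < τ ω}, W ω ∂P :=
      fun hW => by
        rw [hunion]
        exact setIntegral_union hdisj (hmeas (Set.Ioi _)) hW.integrableOn hW.integrableOn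
    have hnow : ∫ ω in {ω | τ ω = i.castSucc}, V (τ ω) ω ∂P =
        ∫ ω in {ω | τ ω = i.castSucc}, V i.castSucc ω ∂P :=
      setIntegral_congr_fun (hmeas {i.castSucc}) fun ω (hω : τ ω = _) => by rw [hω]
    simp only [← Fin.castSucc_lt_iff_succ_le] at ih
    rw [hsplit hVτ, hsplit (hV _), hnow]
    exact add_le_add_right (ih.trans (hstep i)) _

lemma integral_stopped_eq_integral_zero (hV : ∀ i, Integrable (V i) P) (hτ : Measurable τ)
    (hstep : ∀ i : Fin n, ∫ ω in {ω | i.castSucc < τ ω}, V i.succ ω ∂P =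
      ∫ ω in {ω | i.castSucc < τ ω}, V i.castSucc ω ∂P) :
    ∫ ω, V (τ ω) ω ∂P = ∫ ω, V 0 ω ∂P := by
  refine (integral_stopped_le_integral_zero hV hτ fun i => (hstep i).le).antisymm ?_
  have hneg := integral_stopped_le_integral_zero (V := fun i ω => -V i ω) (fun i => (hV i).neg) hτ
    fun i => by simp only [integral_neg, hstep i, le_refl]
  simpa only [integral_neg, neg_le_neg_iff] using hneg

lemma exists_isStoppingTime_first {ℱ : Filtration (Fin (n + 1)) mΩ} {S : Fin (n + 1) → Set Ω}
    (hS : ∀ i, MeasurableSet[ℱ i] (S i)) (hmem : ∀ ω, ∃ i, ω ∈ S i) :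
    ∃ τ : Ω → Fin (n + 1), IsStoppingTime ℱ (fun ω => (τ ω : WithTop (Fin (n + 1)))) ∧
      ∀ ω, ω ∈ S (τ ω) ∧ ∀ i < τ ω, ω ∉ S i := by
  have hfirst : ∀ ω, ∃ i, ω ∈ S i ∧ ∀ j < i, ω ∉ S j := fun ω => by
    obtain ⟨i, hi, hmin⟩ := wellFounded_lt.has_min {i | ω ∈ S i} (hmem ω)
    exact ⟨i, hi, fun j hj hj' => hmin j hj' hj⟩
  choose τ hτ hlt using hfirst
  refine ⟨τ, fun i => ?_, fun ω => ⟨hτ ω, hlt ω⟩⟩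
  have hunion : {ω | (τ ω : WithTop (Fin (n + 1))) ≤ i} = ⋃ j ∈ Set.Iic i, S j := by
    ext ω
    simp only [WithTop.coe_le_coe, Set.mem_iUnion, Set.mem_Iic, exists_prop]
    exact ⟨fun h => ⟨τ ω, h, hτ ω⟩, fun ⟨j, hj, hjS⟩ => (not_lt.1 fun h => hlt ω j h hjS).trans hj⟩
  rw [hunion]
  exact .biUnion (Set.to_countable _) fun j hj => ℱ.mono hj _ (hS j)

end OptionalStopping

/-! ### Optimal stopping of a simulated process -/

section Past

variable {Ω : Type*} {T : ℕ} {X : Fin T → Ω → 𝒳} {k : ℕ}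

lemma past_succ {E : Type*} (X : Fin T → Ω → E) (hk : k < T) (ω : Ω) :
    past X (k + 1) hk ω = extend (past X k hk.le ω, X ⟨k, hk⟩ ω) := by
  ext i
  cases i using Fin.lastCases with
  | last => rw [extend_last]; rfl
  | cast i => simp [past, extend]

variable [MeasurableSpace Ω]

lemma measurable_past (hX : ∀ i, Measurable (X i)) (hk : k ≤ T) : Measurable (past X k hk) :=
  measurable_pi_iff.2 fun _ => hX _

section Natural

variable [TopologicalSpace 𝒳] [TopologicalSpace.MetrizableSpace 𝒳] [BorelSpace 𝒳]
  (hX : ∀ i, StronglyMeasurable (X i))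

lemma measurable_past_natural (hk : k < T) :
    Measurable[Filtration.natural X hX ⟨k, hk⟩] (past X (k + 1) hk) := by
  refine @measurable_pi_iff _ _ _ (_) _ _ |>.2 fun j => ?_
  have hj : Fin.castLE hk j ≤ ⟨k, hk⟩ := Nat.lt_succ_iff.1 j.2
  exact (comap_measurable _).mono (le_iSup₂_of_le (f := fun j (_ : j ≤ (⟨k, hk⟩ : Fin T)) =>
    MeasurableSpace.comap (X j) inferInstance) _ hj le_rfl) le_rfl

lemma exists_preimage_past_of_natural (hk : k < T) {A : Set Ω}
    (hA : MeasurableSet[Filtration.natural X hX ⟨k, hk⟩] A) :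
    ∃ B : Set (Fin (k + 1) → 𝒳), MeasurableSet B ∧ A = past X (k + 1) hk ⁻¹' B := by
  rw [Filtration.natural_eq_comap] at hA
  obtain ⟨B, hB, rfl⟩ := hA
  let toPath : (Fin (k + 1) → 𝒳) → Set.Iic (⟨k, hk⟩ : Fin T) → 𝒳 := fun z j =>
    z ⟨j.1, Nat.lt_succ_of_le (Fin.le_def.1 j.2)⟩
  exact ⟨toPath ⁻¹' B, (measurable_pi_iff.2 fun j => measurable_pi_apply _) hB, rfl⟩

end Natural

end Past

section Simulated

variable {Ω : Type*} [MeasurableSpace Ω] {P : Measure Ω} [IsProbabilityMeasure P] {T : ℕ}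
  {X : Fin T → Ω → 𝒳} {π : (k : ℕ) → Kernel (Fin k → 𝒳) 𝒳}

lemma map_past_eq_historyLaw (hX : ∀ i, Measurable (X i)) (hπ : Simulates P X π) (k : ℕ)
    (hk : k ≤ T) : P.map (past X k hk) = historyLaw π k := by
  induction k with
  | zero =>
    rw [show past X 0 hk = fun _ => Fin.elim0 from funext fun ω => Subsingleton.elim _ _,
      Measure.map_const, measure_univ, one_smul, historyLaw]
  | succ k ih =>
    rw [historyLaw, ← ih (by omega), ← (hπ k hk).map_eq, Measure.map_map measurable_extend
      ((measurable_past hX _).prodMk (hX _))]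
    exact congrArg P.map (funext (past_succ X hk))

lemma integrable_past {k : ℕ} (hX : ∀ i, Measurable (X i)) (hπ : Simulates P X π) (hk : k ≤ T)
    {H : (Fin k → 𝒳) → ℝ} (hH : Integrable H (historyLaw π k)) :
    Integrable (fun ω => H (past X k hk ω)) P :=
  (map_past_eq_historyLaw hX hπ k hk ▸ hH).comp_measurable (measurable_past hX hk)

lemma integrable_historyLaw_last (hX : ∀ i, Measurable (X i)) (hπ : Simulates P X π) {g : 𝒳 → ℝ}
    (hg : Measurable g) (hgi : ∀ i, Integrable (fun ω => g (X i ω)) P) {k : ℕ} (hk : k < T) :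
    Integrable (fun h => g (h (Fin.last k))) (historyLaw π (k + 1)) := by
  have hlast : Measurable fun h : Fin (k + 1) → 𝒳 => g (h (Fin.last k)) := by fun_prop
  rw [← map_past_eq_historyLaw hX hπ (k + 1) hk]
  exact (integrable_map_measure hlast.aestronglyMeasurable
    (measurable_past hX hk).aemeasurable).2 (hgi ⟨k, hk⟩)

lemma setIntegral_past_succ [∀ k, IsMarkovKernel (π k)] (hX : ∀ i, Measurable (X i))
    (hπ : Simulates P X π) {k : ℕ} (hk : k < T) {H : (Fin (k + 1) → 𝒳) → ℝ} (hH : Measurable H)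
    (hHi : Integrable H (historyLaw π (k + 1))) {B : Set (Fin k → 𝒳)} (hB : MeasurableSet B) :
    ∫ ω in past X k hk.le ⁻¹' B, H (past X (k + 1) hk ω) ∂P =
      ∫ ω in past X k hk.le ⁻¹' B, ∫ x, H (extend (past X k hk.le ω, x)) ∂π k (past X k hk.le ω)
        ∂P := by
  have hpast := measurable_past hX hk.le
  have hHe : Measurable fun q : (Fin k → 𝒳) × 𝒳 => H (extend q) := hH.comp measurable_extend
  have hi : Integrable (fun q => H (extend q)) (historyLaw π k ⊗ₘ π k) :=
    hHi.comp_measurable (f := extend) measurable_extend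
  have hcompProd := Measure.setIntegral_compProd hB MeasurableSet.univ hi.integrableOn
  simp only [Measure.restrict_univ] at hcompProd
  have hinner : AEStronglyMeasurable (fun h => ∫ x, H (extend (h, x)) ∂π k h)
      (P.map (past X k hk.le)) :=
    hHe.stronglyMeasurable.integral_kernel_prod_right'.aestronglyMeasurable
  rw [← map_past_eq_historyLaw hX hπ k hk.le] at hcompProd
  rw [← setIntegral_map hB hinner hpast.aemeasurable, ← hcompProd, ← (hπ k hk).map_eq,
    setIntegral_map (hB.prod MeasurableSet.univ) hHe.aestronglyMeasurable
      (hpast.prodMk (hX _)).aemeasurable, Set.mk_preimage_prod, Set.preimage_univ, Set.inter_univ]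
  simp only [past_succ X hk]

end Simulated

section SnellAlong

variable {Ω : Type*} {n : ℕ} {X : Fin (n + 1) → Ω → 𝒳} {π : (k : ℕ) → Kernel (Fin k → 𝒳) 𝒳}
  {f : 𝒳 → ℝ}

/-- The Snell envelope along the process `X`: the value, once `X i` has been observed, of stopping
now or later. -/
def snellAlong (π : (k : ℕ) → Kernel (Fin k → 𝒳) 𝒳) (f : 𝒳 → ℝ) (X : Fin (n + 1) → Ω → 𝒳)
    (i : Fin (n + 1)) (ω : Ω) : ℝ :=
  snell π f (n - i) i (past X (i + 1) i.2 ω)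

lemma snellAlong_last (ω : Ω) : snellAlong π f X (Fin.last n) ω = f (X (Fin.last n) ω) := by
  simp only [snellAlong, Fin.val_last, Nat.sub_self]
  rfl

lemma snellAlong_castSucc (i : Fin n) (ω : Ω) :
    snellAlong π f X i.castSucc ω = max (f (X i.castSucc ω))
      (contValue π f (n - (i + 1)) (i + 1) (past X (i + 1) i.castSucc.2 ω)) := by
  have hsub : n - (i : ℕ) = n - (i + 1) + 1 := by omega
  simp only [snellAlong, Fin.val_castSucc, hsub]
  rfl

lemma le_snellAlong (i : Fin (n + 1)) (ω : Ω) : f (X i ω) ≤ snellAlong π f X i ω := by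
  cases i using Fin.lastCases with
  | last => exact (snellAlong_last ω).ge
  | cast i => exact (le_max_left _ _).trans (snellAlong_castSucc i ω).ge

variable [MeasurableSpace Ω] {P : Measure Ω} [IsProbabilityMeasure P] [∀ k, IsMarkovKernel (π k)]

lemma integrable_snellAlong (hX : ∀ i, Measurable (X i)) (hπ : Simulates P X π)
    (hf : Measurable f) (hfi : ∀ i, Integrable (fun ω => f (X i ω)) P) (i : Fin (n + 1)) :
    Integrable (snellAlong π f X i) P :=
  integrable_past hX hπ i.2 (integrable_snell (T := n + 1)
    (fun _ hk => integrable_historyLaw_last hX hπ hf hfi hk) (n - i) i (by omega))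

lemma setIntegral_snellAlong (hX : ∀ i, Measurable (X i)) (hπ : Simulates P X π)
    (hf : Measurable f) (hfi : ∀ i, Integrable (fun ω => f (X i ω)) P) (i : Fin (n + 1))
    {B : Set (Fin i → 𝒳)} (hB : MeasurableSet B) :
    ∫ ω in past X i i.2.le ⁻¹' B, snellAlong π f X i ω ∂P =
      ∫ ω in past X i i.2.le ⁻¹' B, contValue π f (n - i) i (past X i i.2.le ω) ∂P :=
  setIntegral_past_succ hX hπ i.2 (measurable_snell π hf _ _)
    (integrable_snell (T := n + 1)
      (fun _ hk => integrable_historyLaw_last hX hπ hf hfi hk) (n - i) i (by omega)) hB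

lemma integral_snellAlong_zero (hX : ∀ i, Measurable (X i)) (hπ : Simulates P X π)
    (hf : Measurable f) (hfi : ∀ i, Integrable (fun ω => f (X i ω)) P) :
    ∫ ω, snellAlong π f X 0 ω ∂P = contValue π f n 0 Fin.elim0 := by
  have hset := setIntegral_snellAlong hX hπ hf hfi 0 MeasurableSet.univ
  have hpast : ∀ ω, past X 0 (Nat.zero_le _) ω = Fin.elim0 := fun ω => Subsingleton.elim _ _
  simpa [hpast] using hset

variable [TopologicalSpace 𝒳] [TopologicalSpace.MetrizableSpace 𝒳] [BorelSpace 𝒳]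
  {hX : ∀ i, StronglyMeasurable (X i)}

lemma setIntegral_snellAlong_succ (hπ : Simulates P X π) (hf : Measurable f)
    (hfi : ∀ i, Integrable (fun ω => f (X i ω)) P) {τ : Ω → Fin (n + 1)}
    (hτ : IsStoppingTime (Filtration.natural X hX) fun ω => (τ ω : WithTop (Fin (n + 1))))
    (i : Fin n) :
    ∫ ω in {ω | i.castSucc < τ ω}, snellAlong π f X i.succ ω ∂P =
      ∫ ω in {ω | i.castSucc < τ ω}, contValue π f (n - (i + 1)) (i + 1)
        (past X (i + 1) i.castSucc.2 ω) ∂P := by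
  have hcont : MeasurableSet[Filtration.natural X hX i.castSucc] {ω | i.castSucc < τ ω} := by
    have hgt := hτ.measurableSet_gt i.castSucc
    simp only [WithTop.coe_lt_coe] at hgt
    exact hgt
  obtain ⟨B, hB, hAB⟩ := exists_preimage_past_of_natural hX i.castSucc.2 hcont
  rw [hAB]
  exact setIntegral_snellAlong (fun i => (hX i).measurable) hπ hf hfi i.succ hB

lemma integral_stopped_le_contValue (hπ : Simulates P X π) (hf : Measurable f)
    (hfi : ∀ i, Integrable (fun ω => f (X i ω)) P) {τ : Ω → Fin (n + 1)}
    (hτ : IsStoppingTime (Filtration.natural X hX) fun ω => (τ ω : WithTop (Fin (n + 1)))) :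
    ∫ ω, f (X (τ ω) ω) ∂P ≤ contValue π f n 0 Fin.elim0 := by
  have hXm := fun i => (hX i).measurable
  have hτm := measurable_of_isStoppingTime hτ
  have hV := integrable_snellAlong hXm hπ hf hfi
  calc ∫ ω, f (X (τ ω) ω) ∂P ≤ ∫ ω, snellAlong π f X (τ ω) ω ∂P :=
        integral_mono (integrable_stopped hfi hτm) (integrable_stopped hV hτm)
          fun ω => le_snellAlong _ _
    _ ≤ ∫ ω, snellAlong π f X 0 ω ∂P := by
        refine integral_stopped_le_integral_zero hV hτm fun i => ?_
        rw [setIntegral_snellAlong_succ hπ hf hfi hτ]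
        refine integral_mono (integrable_past (P := P) hXm hπ i.castSucc.2 ?_).integrableOn
          (hV _).integrableOn fun ω => ?_
        · exact integrable_integral_extend (integrable_snell (T := n + 1)
            (fun _ hk => integrable_historyLaw_last hXm hπ hf hfi hk) _ _ (by omega))
        · exact (le_max_right _ _).trans (snellAlong_castSucc i ω).ge
    _ = contValue π f n 0 Fin.elim0 := integral_snellAlong_zero hXm hπ hf hfi

lemma measurableSet_snellAlong_eq (hf : Measurable f) (i : Fin (n + 1)) :
    MeasurableSet[Filtration.natural X hX i] {ω | snellAlong π f X i ω = f (X i ω)} := by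
  have hlast : Measurable fun h : Fin (i + 1) → 𝒳 => f (h (Fin.last i)) := by fun_prop
  exact measurable_past_natural hX i.2
    (measurableSet_eq_fun (measurable_snell π hf (n - i) i) hlast)

lemma exists_integral_stopped_eq_contValue (hπ : Simulates P X π) (hf : Measurable f)
    (hfi : ∀ i, Integrable (fun ω => f (X i ω)) P) :
    ∃ τ : Ω → Fin (n + 1),
      IsStoppingTime (Filtration.natural X hX) (fun ω => (τ ω : WithTop (Fin (n + 1)))) ∧
      ∫ ω, f (X (τ ω) ω) ∂P = contValue π f n 0 Fin.elim0 := by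
  have hXm := fun i => (hX i).measurable
  obtain ⟨τ, hτ, hfirst⟩ := exists_isStoppingTime_first
    (measurableSet_snellAlong_eq (π := π) (hX := hX) hf)
    fun ω => ⟨Fin.last n, snellAlong_last ω⟩
  have hτm := measurable_of_isStoppingTime hτ
  refine ⟨τ, hτ, ?_⟩
  rw [← integral_snellAlong_zero hXm hπ hf hfi,
    ← integral_stopped_eq_integral_zero (integrable_snellAlong hXm hπ hf hfi) hτm]
  · exact integral_congr_ae (.of_forall fun ω => ((hfirst ω).1).symm)
  · intro i
    rw [setIntegral_snellAlong_succ hπ hf hfi hτ]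
    refine setIntegral_congr_fun (hτm (measurableSet_Ioi (a := i.castSucc))) fun ω hω => ?_
    have hne : snellAlong π f X i.castSucc ω ≠ f (X i.castSucc ω) := (hfirst ω).2 _ hω
    rw [snellAlong_castSucc] at hne ⊢
    exact (max_eq_right (le_of_not_ge fun hle => hne (max_eq_left hle))).symm

theorem stoppingValue_eq_contValue (hπ : Simulates P X π) (hf : Measurable f)
    (hfi : ∀ i, Integrable (fun ω => f (X i ω)) P) :
    stoppingValue P X hX f = contValue π f n 0 Fin.elim0 := by
  obtain ⟨τ, hτ, hopt⟩ := exists_integral_stopped_eq_contValue (hX := hX) hπ hf hfi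
  refine IsGreatest.csSup_eq ⟨⟨τ, hτ, hopt.symm⟩, ?_⟩
  rintro _ ⟨σ, hσ, rfl⟩
  exact integral_stopped_le_contValue hπ hf hfi hσ

end SnellAlong

/-! ### The conditional law of the future -/

section Shift

lemma measurable_prepend {m : ℕ} : Measurable (prepend (𝒳 := 𝒳) (m := m)) := by
  refine measurable_pi_iff.2 fun i => ?_
  cases i using Fin.cases with
  | zero => exact measurable_fst
  | succ i => exact (measurable_pi_apply i).comp measurable_snd

lemma extend_prepend {E : Type*} {k : ℕ} (x y : E) (h : Fin k → E) :
    extend (prepend (x, h), y) = prepend (x, extend (h, y)) :=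
  (Fin.cons_snoc_eq_snoc_cons (β := E) x h y).symm

lemma extend_elim0 {E : Type*} (x : E) : extend (Fin.elim0, x) = prepend (x, Fin.elim0) := by
  ext i
  obtain rfl : i = 0 := Fin.fin_one_eq_zero i
  rfl

lemma past_eval_prepend {E : Type*} {m k : ℕ} (hk : k ≤ m) (x : E) (y : Fin m → E) :
    past Function.eval (k + 1) (Nat.succ_le_succ hk) (prepend (x, y)) =
      prepend (x, past Function.eval k hk y) := by
  ext i
  cases i using Fin.cases <;> rfl

/-- The simulator of the process after its first observation `x`. -/
def shift (π : (k : ℕ) → Kernel (Fin k → 𝒳) 𝒳) (x : 𝒳) (k : ℕ) : Kernel (Fin k → 𝒳) 𝒳 :=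
  (π (k + 1)).comap (fun h => prepend (x, h)) (measurable_prepend.comp measurable_prodMk_left)

variable (π : (k : ℕ) → Kernel (Fin k → 𝒳) 𝒳)

instance isMarkovKernel_shift [∀ k, IsMarkovKernel (π k)] (x : 𝒳) (k : ℕ) :
    IsMarkovKernel (shift π x k) := by
  rw [shift]
  infer_instance

lemma snell_prepend (f : 𝒳 → ℝ) (m k : ℕ) (x : 𝒳) (h : Fin (k + 1) → 𝒳) :
    snell π f m (k + 1) (prepend (x, h)) = snell (shift π x) f m k h := by
  induction m generalizing k with
  | zero => rfl
  | succ m ih =>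
    simp only [snell, extend_prepend, ih]
    rfl

lemma contValue_prepend (f : 𝒳 → ℝ) (m k : ℕ) (x : 𝒳) (h : Fin k → 𝒳) :
    contValue π f m (k + 1) (prepend (x, h)) = contValue (shift π x) f m k h := by
  simp only [contValue, extend_prepend, snell_prepend]
  rfl

variable [∀ k, IsMarkovKernel (π k)]

instance isMarkovKernel_tailLaw (m k : ℕ) : IsMarkovKernel (tailLaw π m k) := by
  induction m generalizing k with
  | zero => rw [tailLaw]; infer_instance
  | succ m ih =>
    rw [tailLaw]
    exact Kernel.IsMarkovKernel.map _ measurable_prepend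

lemma lintegral_tailLaw_succ (m k : ℕ) (h : Fin k → 𝒳) {F : (Fin (m + 1) → 𝒳) → ENNReal}
    (hF : Measurable F) :
    ∫⁻ y, F y ∂tailLaw π (m + 1) k h =
      ∫⁻ x, ∫⁻ y, F (prepend (x, y)) ∂tailLaw π m (k + 1) (extend (h, x)) ∂π k h := by
  rw [tailLaw, Kernel.lintegral_map _ measurable_prepend _ hF]
  exact Kernel.lintegral_compProd _ _ _ (hF.comp measurable_prepend)

lemma tailLaw_prepend (m k : ℕ) (x : 𝒳) (h : Fin k → 𝒳) :
    tailLaw π m (k + 1) (prepend (x, h)) = tailLaw (shift π x) m k h := by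
  induction m generalizing k with
  | zero => rfl
  | succ m ih =>
    refine Measure.ext_of_lintegral _ fun F hF => ?_
    simp only [lintegral_tailLaw_succ _ _ _ _ hF, extend_prepend, ih]
    rfl

lemma condUtility_prepend [TopologicalSpace 𝒳] [TopologicalSpace.MetrizableSpace 𝒳] [BorelSpace 𝒳]
    [SecondCountableTopology 𝒳] (f : 𝒳 → ℝ) (m k : ℕ) (x : 𝒳) (h : Fin k → 𝒳) :
    condUtility π f m (k + 1) (prepend (x, h)) = condUtility (shift π x) f m k h := by
  simp only [condUtility, tailLaw_prepend]

lemma lintegral_tailLaw_succ_zero (m : ℕ) {F : (Fin (m + 1) → 𝒳) → ENNReal} (hF : Measurable F) :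
    ∫⁻ y, F y ∂tailLaw π (m + 1) 0 Fin.elim0 = ∫⁻ x, ∫⁻ y, F (prepend (x, y))
      ∂tailLaw (shift π x) m 0 Fin.elim0 ∂π 0 Fin.elim0 := by
  simp only [lintegral_tailLaw_succ _ _ _ _ hF, extend_elim0, tailLaw_prepend]

lemma lintegral_tailLaw_past {m k : ℕ} (hk : k < m) {F : (Fin k → 𝒳) → 𝒳 → ENNReal}
    (hF : Measurable (Function.uncurry F)) :
    ∫⁻ y, F (past Function.eval k hk.le y) (y ⟨k, hk⟩) ∂tailLaw π m 0 Fin.elim0 =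
      ∫⁻ y, ∫⁻ x, F (past Function.eval k hk.le y) x ∂π k (past Function.eval k hk.le y)
        ∂tailLaw π m 0 Fin.elim0 := by
  induction m generalizing k π with
  | zero => omega
  | succ m ih =>
    have hpast := measurable_past (X := Function.eval (β := fun _ : Fin (m + 1) => 𝒳))
      measurable_pi_apply hk.le
    have hnow := lintegral_tailLaw_succ_zero π m
      (F := fun y => F (past Function.eval k hk.le y) (y ⟨k, hk⟩))
      (hF.comp (hpast.prodMk (measurable_pi_apply _)))
    have hnext := lintegral_tailLaw_succ_zero π m
      ((hF.lintegral_kernel_prod_right (κ := π k)).comp hpast)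
    refine hnow.trans (Eq.trans ?_ hnext.symm)
    cases k with
    | zero =>
      have helim : ∀ y : Fin (m + 1) → 𝒳, past Function.eval 0 hk.le y = Fin.elim0 := fun y =>
        Subsingleton.elim _ _
      have hhead : ∀ (x : 𝒳) (y : Fin m → 𝒳), prepend (x, y) ⟨0, hk⟩ = x := fun _ _ => rfl
      simp only [Function.comp_apply, helim, hhead, lintegral_const, measure_univ, mul_one]
    | succ k =>
      have hk' := Nat.succ_lt_succ_iff.1 hk
      refine lintegral_congr fun x => ?_
      simp only [Function.comp_apply, past_eval_prepend hk'.le]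
      exact ih (shift π x) hk' (F := fun h => F (prepend (x, h))) (hF.comp
        ((measurable_prepend.comp (measurable_prodMk_left.comp measurable_fst)).prodMk
          measurable_snd))

theorem simulates_tailLaw (m : ℕ) :
    Simulates (tailLaw π m 0 Fin.elim0) (Function.eval (β := fun _ : Fin m => 𝒳)) π :=
  fun k hk => by
    have hpast := measurable_past (X := Function.eval (β := fun _ : Fin m => 𝒳))
      measurable_pi_apply hk.le
    have hpair := hpast.prodMk (measurable_pi_apply (X := fun _ : Fin m => 𝒳) ⟨k, hk⟩)
    refine ⟨hpair.aemeasurable, Measure.ext_of_lintegral _ fun F hF => ?_⟩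
    rw [lintegral_map hF hpair, Measure.lintegral_compProd hF,
      lintegral_map hF.lintegral_kernel_prod_right' hpast]
    exact lintegral_tailLaw_past π hk (F := fun h x => F (h, x)) hF

end Shift

section CondUtility

variable (π : (k : ℕ) → Kernel (Fin k → 𝒳) 𝒳) [∀ k, IsMarkovKernel (π k)] {f : 𝒳 → ℝ}

theorem condUtility_succ_eq_contValue [TopologicalSpace 𝒳] [TopologicalSpace.MetrizableSpace 𝒳]
    [BorelSpace 𝒳] [SecondCountableTopology 𝒳] (hf : Measurable f) {m k : ℕ} {h : Fin k → 𝒳}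
    (hfi : ∀ i, Integrable (fun y => f (y i)) (tailLaw π (m + 1) k h)) :
    condUtility π f (m + 1) k h = contValue π f m k h := by
  induction k generalizing π with
  | zero =>
    rw [Subsingleton.elim h Fin.elim0] at hfi ⊢
    exact stoppingValue_eq_contValue (simulates_tailLaw π (m + 1)) hf hfi
  | succ k ih =>
    obtain ⟨x, y, rfl⟩ : ∃ x y, h = prepend (x, y) := ⟨h 0, Fin.tail h, (Fin.cons_self_tail h).symm⟩
    simp only [tailLaw_prepend] at hfi
    rw [condUtility_prepend, contValue_prepend, ih (shift π x) hfi]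

lemma lintegral_lintegral_tailLaw_lt_top {T : ℕ} {g : 𝒳 → ENNReal} (hg : Measurable g)
    (hgT : ∀ k < T, ∫⁻ h, g (h (Fin.last k)) ∂historyLaw π (k + 1) < ⊤) {m k : ℕ}
    (hk : k + m ≤ T) (i : Fin m) :
    ∫⁻ h, ∫⁻ y, g (y i) ∂tailLaw π m k h ∂historyLaw π k < ⊤ := by
  induction m generalizing k with
  | zero => exact i.elim0
  | succ m ih =>
    have hgi : ∀ {n} (i : Fin n), Measurable fun y : Fin n → 𝒳 => g (y i) := fun i =>
      hg.comp (measurable_pi_apply i)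
    cases i using Fin.cases with
    | zero =>
      have hnext := lintegral_historyLaw_succ π k (hgi (Fin.last k))
      simp only [extend_last] at hnext
      simp only [lintegral_tailLaw_succ π m k _ (hgi 0)]
      simpa [prepend, ← hnext] using hgT k (by omega)
    | succ i =>
      simp only [lintegral_tailLaw_succ π m k _ (hgi i.succ)]
      exact (lintegral_historyLaw_succ π k (hgi i).lintegral_kernel).symm.trans_lt
        (ih (k := k + 1) (by omega) i)

lemma ae_condUtility_succ_eq_contValue [TopologicalSpace 𝒳] [TopologicalSpace.MetrizableSpace 𝒳]
    [BorelSpace 𝒳] [SecondCountableTopology 𝒳] {T : ℕ} (hf : Measurable f)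
    (hfi : ∀ k < T, Integrable (fun h => f (h (Fin.last k))) (historyLaw π (k + 1))) {m k : ℕ}
    (hk : k + m + 1 ≤ T) :
    ∀ᵐ h ∂historyLaw π k, condUtility π f (m + 1) k h = contValue π f m k h := by
  have hlt := lintegral_lintegral_tailLaw_lt_top π hf.enorm (fun k hk => (hfi k hk).2)
    (m := m + 1) hk
  have hae : ∀ᵐ h ∂historyLaw π k, ∀ i, ∫⁻ y, ‖f (y i)‖ₑ ∂tailLaw π (m + 1) k h < ⊤ :=
    ae_all_iff.2 fun i => ae_lt_top
      (hf.comp (measurable_pi_apply i)).enorm.lintegral_kernel (hlt i).ne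
  filter_upwards [hae] with h hh
  exact condUtility_succ_eq_contValue π hf fun i =>
    ⟨(hf.comp (measurable_pi_apply i)).aestronglyMeasurable, hh i⟩

end CondUtility

section Transfer

variable {Ω : Type*} [MeasurableSpace Ω] {P : Measure Ω}

lemma integrable_abs_rpow_of_linear_growth [IsFiniteMeasure P] {E : Type*} [NormedAddCommGroup E]
    {X : Ω → E} {f : E → ℝ} {p q L : ℝ} (hp : 0 < p) (hq : 0 ≤ q) (hqp : q ≤ p)
    (hX : AEStronglyMeasurable X P) (hXp : Integrable (fun ω => ‖X ω‖ ^ p) P)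
    (hfX : AEStronglyMeasurable (fun ω => f (X ω)) P) (hL : ∀ x, |f x| ≤ L * (1 + ‖x‖)) :
    Integrable (fun ω => |f (X ω)| ^ q) P := by
  have hp0 : ENNReal.ofReal p ≠ 0 := (ENNReal.ofReal_pos.2 hp).ne'
  have hXLp : MemLp X (ENNReal.ofReal p) P :=
    (integrable_norm_rpow_iff hX hp0 ENNReal.ofReal_ne_top).1
      (by simpa only [ENNReal.toReal_ofReal hp.le] using hXp)
  have hbound : MemLp (fun ω => L * (1 + ‖X ω‖)) (ENNReal.ofReal p) P :=
    ((memLp_const (1 : ℝ)).add hXLp.norm).const_mul L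
  have hfLp : MemLp (fun ω => f (X ω)) (ENNReal.ofReal p) P :=
    hbound.mono' hfX (ae_of_all _ fun ω => hL (X ω))
  exact integrable_abs_rpow hq hqp hfLp

lemma integrable_of_integrable_abs_rpow [IsFiniteMeasure P] {g : Ω → ℝ} {p : ℝ} (hp : 1 ≤ p)
    (hg : AEStronglyMeasurable g P) (hgp : Integrable (fun ω => |g ω| ^ p) P) :
    Integrable g P := by
  have hp0 : 0 < p := by linarith
  have hLp : MemLp g (ENNReal.ofReal p) P :=
    (integrable_norm_rpow_iff hg (ENNReal.ofReal_pos.2 hp0).ne' ENNReal.ofReal_ne_top).1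
      (by simpa only [ENNReal.toReal_ofReal hp0.le, Real.norm_eq_abs] using hgp)
  exact hLp.integrable (ENNReal.one_le_ofReal.2 hp)

variable [IsProbabilityMeasure P] {T : ℕ} {X : Fin T → Ω → 𝒳}
  {π : (k : ℕ) → Kernel (Fin k → 𝒳) 𝒳} [∀ k, IsMarkovKernel (π k)] {f : 𝒳 → ℝ}
  [TopologicalSpace 𝒳] [TopologicalSpace.MetrizableSpace 𝒳] [BorelSpace 𝒳]
  [SecondCountableTopology 𝒳]

lemma historyLaw_abs_contValue_sub_lt_le (hX : ∀ i, Measurable (X i)) (hπ : Simulates P X π)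
    (hf : Measurable f) (hfi : ∀ i, Integrable (fun ω => f (X i ω)) P) {m k : ℕ}
    (hk : k + 1 + m + 1 = T) {ε c : ℝ}
    (hc : P.real {ω | |condUtility π f (T - (k + 1)) (k + 1) (past X (k + 1) (by omega) ω) -
      f (X ⟨k, by omega⟩ ω)| < ε} ≤ c) :
    historyLaw π (k + 1) {h | |contValue π f m (k + 1) h - f (h (Fin.last k))| < ε} ≤
      ENNReal.ofReal c := by
  obtain rfl : T = k + 1 + m + 1 := hk.symm
  have hpast := measurable_past hX (by omega : k + 1 ≤ k + 1 + m + 1)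
  have hmeas : MeasurableSet {h | |contValue π f m (k + 1) h - f (h (Fin.last k))| < ε} :=
    measurableSet_lt ((measurable_contValue π hf m (k + 1)).sub
      (hf.comp (measurable_pi_apply _))).abs measurable_const
  have hutility := ae_condUtility_succ_eq_contValue π hf
    (fun _ hj => integrable_historyLaw_last hX hπ hf hfi hj) (k := k + 1) (m := m) le_rfl
  rw [← map_past_eq_historyLaw hX hπ (k + 1) (by omega)] at hutility ⊢
  rw [Measure.map_apply hpast hmeas]
  refine (measure_mono_ae ?_).trans
    ((ENNReal.le_ofReal_iff_toReal_le (measure_ne_top P _) ?_).2 hc)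
  · filter_upwards [ae_of_ae_map hpast.aemeasurable hutility] with ω hω hlt
    rw [show k + 1 + m + 1 - (k + 1) = m + 1 by omega]
    exact (congrArg (|· - f (X ⟨k, by omega⟩ ω)| < ε) hω).mpr hlt
  · exact measureReal_nonneg.trans hc

end Transfer

end MUSE

end

theorem corollary1_general
    {𝒳 : Type*} [TopologicalSpace 𝒳] [TopologicalSpace.MetrizableSpace 𝒳]
    [SecondCountableTopology 𝒳] [MeasurableSpace 𝒳] [BorelSpace 𝒳]
    {Ω : Type*} [MeasurableSpace Ω] (P : Measure Ω) [IsProbabilityMeasure P]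
    (T : ℕ) (hT : 1 ≤ T)
    (X : Fin T → Ω → 𝒳) (hX : ∀ i, StronglyMeasurable (X i))
    (π : (k : ℕ) → Kernel (Fin k → 𝒳) 𝒳) [∀ k, IsMarkovKernel (π k)]
    (hπ : MUSE.Simulates P X π)
    (η : ℝ) (hη : 0 < η) (hη4 : η < 1 / 4)
    (f : 𝒳 → ℝ) (hf : Measurable f)
    (hmoment : ∀ i, Integrable (fun ω => |f (X i ω)| ^ (2 + η)) P)
    (C : ℝ)
    (hC : ∀ (k : ℕ) (hk : k + 1 < T) (ε : ℝ), 0 < ε →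
      P.real {ω | |MUSE.condUtility π f (T - (k + 1)) (k + 1) (MUSE.past X (k + 1) hk.le ω)
        - f (X ⟨k, Nat.lt_of_succ_lt hk⟩ ω)| < ε} ≤ C * ε) :
    let μ : Measure (ℝ × ℕ) := MUSE.museLaw π f (MUSE.museParam T η hη) T
    let n : ℝ → ℕ := fun ε => MUSE.sampleSize (variance (fun z : ℝ × ℕ => z.1) μ) ε
    let ν : ℝ → Measure (ℝ × ℕ) := fun ε => MUSE.averageLaw μ (n ε)
    IsProbabilityMeasure μ ∧ MemLp (fun z : ℝ × ℕ => z.1) 2 μ ∧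
    ∃ K : ℝ, ∀ ε : ℝ, 0 < ε →
      IsProbabilityMeasure (ν ε) ∧
      ∫⁻ z, ENNReal.ofReal ((z.1 - MUSE.stoppingValue P X hX f) ^ 2) ∂(ν ε)
        ≤ ENNReal.ofReal (ε ^ 2) ∧
      ∫⁻ z, (z.2 : ENNReal) ∂(ν ε) ≤ ENNReal.ofReal (K * max 1 (1 / ε ^ 2)) := by
  intro μ n ν
  obtain ⟨m, rfl⟩ : ∃ m, T = m + 1 := ⟨T - 1, by omega⟩
  have hXm i := (hX i).measurable
  have hfi i := MUSE.integrable_of_integrable_abs_rpow (by linarith : 1 ≤ 2 + η)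
    (hf.comp (hXm i)).aestronglyMeasurable (hmoment i)
  obtain ⟨hmom, hmean⟩ := MUSE.muse_moment_and_mean π hf hη hη4
    (fun k hk => (MUSE.integrable_historyLaw_last hXm hπ (g := fun x => |f x| ^ (2 + η))
      (hf.abs.pow_const _) hmoment hk).lintegral_lt_top)
    (fun j k hk ε hε => MUSE.historyLaw_abs_contValue_sub_lt_le hXm hπ hf hfi hk
      (hC k (by omega) ε hε)) m 0 (by omega)
  obtain ⟨h, hL2, hmean⟩ := ((MUSE.ae_memLp_muse π hf (MUSE.two_lt_momentExponent hη).le hmom).and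
    hmean).exists
  rw [Subsingleton.elim h Fin.elim0] at hL2 hmean
  rw [← MUSE.stoppingValue_eq_contValue (hX := hX) hπ hf hfi] at hmean
  have hμ : IsProbabilityMeasure μ := (MUSE.isMarkovKernel_muse π hf _ m 0).isProbabilityMeasure _
  obtain ⟨c, hc, hcost⟩ := MUSE.exists_lintegral_cost_muse_le π hf (m := m) (k := 0)
    (r := MUSE.museParam (m + 1) η hη)
    fun | i + 1, _, him => MUSE.half_lt_museParam hη hη4 (by omega)
  obtain ⟨K, hK⟩ := MUSE.exists_averageLaw_error_and_cost_le (μ := μ) hL2 ((hcost _).trans_lt hc)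
  exact ⟨hμ, hL2, K, fun ε hε => ⟨inferInstance, hmean ▸ (hK ε hε).1, (hK ε hε).2⟩⟩

theorem corollary1
    {𝒳 : Type*} [NormedAddCommGroup 𝒳] [NormedSpace ℝ 𝒳] [CompleteSpace 𝒳]
    [SecondCountableTopology 𝒳] [MeasurableSpace 𝒳] [BorelSpace 𝒳]
    {Ω : Type*} [MeasurableSpace Ω] (P : Measure Ω) [IsProbabilityMeasure P]
    (T : ℕ) (hT : 1 ≤ T)
    -- the process and its simulator
    (X : Fin T → Ω → 𝒳) (hX : ∀ i, StronglyMeasurable (X i))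
    (π : (k : ℕ) → Kernel (Fin k → 𝒳) 𝒳) [∀ k, IsMarkovKernel (π k)]
    (hπ : MUSE.Simulates P X π)
    -- moments
    (δ : ℝ) (hδ : 0 < δ) (hmoment : ∀ i, Integrable (fun ω => ‖X i ω‖ ^ (2 + δ)) P)
    -- linear growth of the reward
    (f : 𝒳 → ℝ) (hf : Measurable f) (L : ℝ) (hL : ∀ x, |f x| ≤ L * (1 + ‖x‖))
    -- regularity of the conditional utility
    (C : ℝ)
    (hC : ∀ (k : ℕ) (hk : k + 1 < T) (ε : ℝ), 0 < ε →
      P.real {ω | |MUSE.condUtility π f (T - (k + 1)) (k + 1) (MUSE.past X (k + 1) hk.le ω)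
        - f (X ⟨k, by omega⟩ ω)| < ε} ≤ C * ε) :
    ∀ (η : ℝ) (hη : 0 < η), η ≤ δ → η < 1 / 4 →
      let μ : Measure (ℝ × ℕ) := MUSE.museLaw π f (MUSE.museParam T η hη) T
      let n : ℝ → ℕ := fun ε => MUSE.sampleSize (variance (fun z : ℝ × ℕ => z.1) μ) ε
      let ν : ℝ → Measure (ℝ × ℕ) := fun ε => MUSE.averageLaw μ (n ε)
      IsProbabilityMeasure μ ∧ MemLp (fun z : ℝ × ℕ => z.1) 2 μ ∧
      ∃ K : ℝ, ∀ ε : ℝ, 0 < ε →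
        IsProbabilityMeasure (ν ε) ∧
        ∫⁻ z, ENNReal.ofReal ((z.1 - MUSE.stoppingValue P X hX f) ^ 2) ∂(ν ε)
          ≤ ENNReal.ofReal (ε ^ 2) ∧
        ∫⁻ z, (z.2 : ENNReal) ∂(ν ε) ≤ ENNReal.ofReal (K * max 1 (1 / ε ^ 2)) :=
  fun η hη hηδ hη4 => corollary1_general P T hT X hX π hπ η hη hη4 f hf (fun i =>
    MUSE.integrable_abs_rpow_of_linear_growth (p := 2 + δ) (by linarith) (by linarith) (by linarith)
      (hX i).aestronglyMeasurable (hmoment i) (hf.comp (hX i).measurable).aestronglyMeasurable hL)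
    C hC
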